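/- Let $(X_i)_{i\ge 1}$ be i.i.d. Poisson random variables of parameter $1$, let $S_m=\sum_{i=1}^m (X_i-1)$ for $m\ge 0$, and let $\tau_{-1}=\min\{m\ge 1: S_m=-1\}$. For $n \ge 2$ let $\mathbb{E}_n=\mathbb{E}[\,\cdot\mid \tau_{-1}=n+1]$ be the expectation conditional on the event $\{\tau_{-1}=n+1\}$, which has positive probability. There exists a constant $C>0$ such that for all integers $n\ge 2$ and $1\le k\le n-1$ and all real $d\ge 1$ the moment $\mathbb{E}_n[S_k^d]$ is finite and (i) $\mathbb{E}_n[S_k^d]\le (Cdn)^{d/2}$; (ii) $\mathbb{E}_n[S_{n-k}^d]\le \left(\frac{n}{n-k}\right)^{3/2}(Cdk)^{d/2}$; (iii) $\mathbb{E}_n[S_k^d]\le \left(\frac{n}{n-k}\right)^{3/2}(Cd\sqrt{k})^d$. -/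

import Mathlib

open MeasureTheory ProbabilityTheory

/-- The walk `S_n = ∑_{i=1}^n (X_i - 1)`; the variable `X_i` of the sequence `(X_i)_{i ≥ 1}` is
`X (i - 1)` here. -/
def walk {Ω : Type*} (X : ℕ → Ω → ℕ) (n : ℕ) (ω : Ω) : ℤ :=
  ∑ i ∈ Finset.range n, ((X i ω : ℤ) - 1)

/-- `τ_a = min {n ≥ 1 : S_n = a}`, with value `⊤` if `a` is never reached. -/
noncomputable def hitTime {Ω : Type*} (X : ℕ → Ω → ℕ) (a : ℤ) : Ω → WithTop ℕ :=
  hittingAfter (walk X) {a} 1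

/-- The event `{τ_{-1} = n + 1}` that the walk makes an excursion of length `n + 1`. -/
def excursion {Ω : Type*} (X : ℕ → Ω → ℕ) (n : ℕ) : Set Ω :=
  {ω | hitTime X (-1) ω = ((n + 1 : ℕ) : WithTop ℕ)}

/-- The conditional probability `ℙ_n = ℙ(· | τ_{-1} = n + 1)`. -/
noncomputable def excursionMeasure {Ω : Type*} [MeasurableSpace Ω] (P : Measure Ω)
    (X : ℕ → Ω → ℕ) (n : ℕ) : Measure Ω :=
  ProbabilityTheory.cond P (excursion X n)

/-- The moment `E_n[S_k ^ d]` of order `d` under the conditional probability `ℙ_n`. -/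
noncomputable def excursionMoment {Ω : Type*} [MeasurableSpace Ω] (P : Measure Ω)
    (X : ℕ → Ω → ℕ) (n k : ℕ) (d : ℝ) : ℝ :=
  ∫ ω, (walk X k ω : ℝ) ^ d ∂(excursionMeasure P X n)

/-! Let `m = n + 1 - k`. The Markov property at time `k` gives the conditional law of `S_k` at `x`
as `aliveProb k x * hitProb m (x + 1) / hitProb (n + 1) 1`, where `x + 1` is the distance to `-1`.
The moment is thus a finite sum (`moment_eq`), and the Kemperman formula makes `hitProb` explicit.
By Stirling, the quotient of the two hitting probabilities is at most `3 ((n + 1) / m)^(3/2) (x + 1)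
exp (-x² / (2m))` (`hitProb_div_le`).

The factor `aliveProb k x` is controlled in three ways. Since `x + 1` is harmonic for the killed
walk, `(x + 1) * aliveProb k x` has total mass at most `1`; absorbing `x^d` in the Gaussian factor
then gives (i) for `k ≤ n / 2`. Since `sinh (s (x + 1))` is almost harmonic, with `s = 1 / √k` this
mass has a bounded exponential moment at scale `√k`, which gives (iii). Finally `aliveProb m x ≤ C
(x + 1) / m^(3/2)` (`aliveProb_le`). At time `n - k` the Gaussian sum over `x` produces the power
`3/2` of `k + 1` that cancels the one in `hitProb`, which gives (ii), and hence (i) for `k > n / 2`.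

The pointwise bound comes from cutting time into three: survival during the first third costs `1 /
√m`, a local limit estimate in the middle costs `1 / √m`, and survival of the reversed walk in the
last third costs `(x + 1) / √m`. Both survival estimates follow from exponential martingales,
written as inductions on the one-step recursion. -/

namespace PoissonExcursion

open Finset
open scoped Nat

/-- The Poisson weight of parameter `m` at `r`. -/
noncomputable def poissonWeight (m r : ℕ) : ℝ := Real.exp (-m) * (m : ℝ) ^ r / r !

/-- The transition operator of the time-reversed walk, killed below `0`. -/
noncomputable def killedStep (g : ℕ → ℝ) (x : ℕ) : ℝ :=
  ∑ i ∈ range (x + 2), poissonWeight 1 i * g (x + 1 - i)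

/-- The probability that the walk stays nonnegative up to time `k` and is at `x` at that time. -/
noncomputable def aliveProb (k : ℕ) : ℕ → ℝ := killedStep^[k] (fun x => if x = 0 then 1 else 0)

/-- The probability that the time-reversed walk started from `x` stays nonnegative up to
time `k`. -/
noncomputable def dualAliveProb (k : ℕ) : ℕ → ℝ := killedStep^[k] (fun _ => 1)

/-- The probability that the walk started from `y` hits `0` for the first time at time `m`. -/
noncomputable def hitProb : ℕ → ℕ → ℝ
  | 0, y => if y = 0 then 1 else 0
  | m + 1, y => if y ≤ m + 1 then (y : ℝ) / (m + 1) * poissonWeight (m + 1) (m + 1 - y) else 0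

/-! ### Poisson convolutions and the one-step recursions. -/

lemma poissonWeight_nonneg (m r : ℕ) : 0 ≤ poissonWeight m r := by
  unfold poissonWeight; positivity

lemma poissonWeight_one (i : ℕ) : poissonWeight 1 i = Real.exp (-1) / i ! := by
  simp [poissonWeight]

lemma hasSum_poissonWeight_one_mul_pow (t : ℝ) :
    HasSum (fun i => poissonWeight 1 i * t ^ i) (Real.exp (t - 1)) := by
  have h := (NormedSpace.expSeries_div_hasSum_exp t).mul_left (Real.exp (-1))
  rw [← Real.exp_eq_exp_ℝ, ← Real.exp_add, neg_add_eq_sub] at h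
  refine (funext fun i => ?_ : (fun i => poissonWeight 1 i * t ^ i) = _) ▸ h
  rw [poissonWeight_one]
  ring

lemma sum_poissonWeight_mul (b N : ℕ) :
    ∑ i ∈ range (N + 1), poissonWeight 1 i * poissonWeight b (N - i)
      = poissonWeight (b + 1) N := by
  have h := add_pow (1 : ℝ) (b : ℝ) N
  unfold poissonWeight
  push_cast
  rw [add_comm (b : ℝ) 1, h, neg_add, Real.exp_add, mul_sum, sum_div]
  refine sum_congr rfl fun i hi => ?_
  have hi' : i ≤ N := Nat.lt_succ_iff.1 (mem_range.1 hi)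
  rw [Nat.cast_choose ℝ hi']
  have : (N ! : ℝ) ≠ 0 := by positivity
  field_simp

lemma poissonWeight_succ (m r : ℕ) :
    poissonWeight m (r + 1) = poissonWeight m r * m / (r + 1) := by
  unfold poissonWeight
  rw [Nat.factorial_succ]
  push_cast
  field_simp
  ring

/-- Given that their sum is `N`, the unit-rate summand among `b + 1` units of rate is binomial with
mean `N / (b + 1)`. The proof uses the size-biasing identity `(i + 1) p (i + 1) = p i`. -/
lemma sum_mul_poissonWeight_mul (b N : ℕ) :
    ∑ i ∈ range (N + 1), (i : ℝ) * (poissonWeight 1 i * poissonWeight b (N - i))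
      = N / (b + 1) * poissonWeight (b + 1) N := by
  rw [sum_range_succ']
  rcases N with _ | N
  · simp
  · have e : ((N + 1 : ℕ) : ℝ) / (b + 1) * poissonWeight (b + 1) (N + 1)
        = poissonWeight (b + 1) N := by
      rw [poissonWeight_succ]
      push_cast
      field_simp
    rw [e, ← sum_poissonWeight_mul b N, Nat.cast_zero, zero_mul, add_zero]
    refine sum_congr rfl fun i hi => ?_
    rw [poissonWeight_succ, show N + 1 - (i + 1) = N - i by omega]
    push_cast
    field_simp

lemma hitProb_eq_zero {m y : ℕ} (h : m < y) : hitProb m y = 0 := by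
  cases m with
  | zero => simp [hitProb, h.ne']
  | succ m => simp [hitProb, h]

lemma hitProb_nonneg (m y : ℕ) : 0 ≤ hitProb m y := by
  cases m with
  | zero => rw [hitProb]; split_ifs <;> simp
  | succ m =>
    have := poissonWeight_nonneg (m + 1) (m + 1 - y)
    rw [hitProb]; split_ifs <;> positivity

lemma hitProb_zero_right (m : ℕ) : hitProb m 0 = if m = 0 then 1 else 0 := by
  cases m <;> simp [hitProb]

/-- First-step analysis of the Kemperman formula: the prefactor `y + i` is split into `y` and `i`,
handled by the convolution and its size-biased version. Truncating at `m` loses nothing, because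
each step goes down by at most one. -/
lemma sum_hitProb (m y : ℕ) :
    ∑ i ∈ range (m + 1), poissonWeight 1 i * hitProb m (y + i) = hitProb (m + 1) (y + 1) := by
  rcases m with _ | M
  · rcases y with _ | y
    · simp [hitProb, poissonWeight]
    · simp [hitProb]
  by_cases hy : y ≤ M + 1
  swap
  · rw [hitProb_eq_zero (by omega)]
    exact sum_eq_zero fun i _ => by rw [hitProb_eq_zero (by omega), mul_zero]
  obtain ⟨N, hN⟩ := Nat.exists_eq_add_of_le hy
  have hsub : range (N + 1) ⊆ range (M + 1 + 1) := range_mono (by omega)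
  rw [← sum_subset hsub fun i _ hi => by
    rw [hitProb_eq_zero (by simp at hi; omega), mul_zero]]
  have e : ∀ i ∈ range (N + 1), poissonWeight 1 i * hitProb (M + 1) (y + i)
      = (y : ℝ) / (M + 1) * (poissonWeight 1 i * poissonWeight (M + 1) (N - i))
        + 1 / (M + 1) * ((i : ℝ) * (poissonWeight 1 i * poissonWeight (M + 1) (N - i))) := by
    intro i hi
    have hi' := mem_range.1 hi
    rw [hitProb, if_pos (by omega), show M + 1 - (y + i) = N - i by omega]
    push_cast
    ring
  rw [sum_congr rfl e, sum_add_distrib, ← mul_sum, ← mul_sum, sum_poissonWeight_mul,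
    sum_mul_poissonWeight_mul, hitProb, if_pos (by omega), show M + 1 + 1 - (y + 1) = N by omega]
  have hN' : (N : ℝ) = M + 1 - y := by
    have : ((M + 1 : ℕ) : ℝ) = (y + N : ℕ) := by rw [hN]
    push_cast at this; linarith
  push_cast
  rw [hN']
  field_simp
  ring

lemma hasSum_hitProb (m y : ℕ) :
    HasSum (fun i => poissonWeight 1 i * hitProb m (y + i)) (hitProb (m + 1) (y + 1)) := by
  rw [← sum_hitProb]
  refine hasSum_sum_of_ne_finset_zero fun i hi => ?_
  rw [hitProb_eq_zero (by simp at hi; omega), mul_zero]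

lemma killedStep_nonneg {g : ℕ → ℝ} (hg : ∀ x, 0 ≤ g x) (x : ℕ) : 0 ≤ killedStep g x :=
  sum_nonneg fun _ _ => mul_nonneg (poissonWeight_nonneg _ _) (hg _)

lemma iterate_killedStep_nonneg {g : ℕ → ℝ} (hg : ∀ x, 0 ≤ g x) (k x : ℕ) :
    0 ≤ killedStep^[k] g x := by
  induction k generalizing x with
  | zero => exact hg x
  | succ k ih => rw [Function.iterate_succ_apply']; exact killedStep_nonneg ih x

lemma aliveProb_nonneg (k x : ℕ) : 0 ≤ aliveProb k x :=
  iterate_killedStep_nonneg (fun x => by split_ifs <;> simp) k x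

lemma dualAliveProb_nonneg (k x : ℕ) : 0 ≤ dualAliveProb k x :=
  iterate_killedStep_nonneg (fun _ => zero_le_one) k x

lemma aliveProb_succ (k x : ℕ) : aliveProb (k + 1) x
    = ∑ i ∈ range (x + 2), poissonWeight 1 i * aliveProb k (x + 1 - i) := by
  rw [aliveProb, Function.iterate_succ_apply']; rfl

lemma dualAliveProb_succ (k x : ℕ) : dualAliveProb (k + 1) x
    = ∑ i ∈ range (x + 2), poissonWeight 1 i * dualAliveProb k (x + 1 - i) := by
  rw [dualAliveProb, Function.iterate_succ_apply']; rfl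

/-- Summation by parts in the recursion of `aliveProb`. -/
lemma sum_mul_aliveProb_succ (h : ℕ → ℝ) (k N : ℕ) :
    ∑ x ∈ range N, h (x + 1) * aliveProb (k + 1) x + h 0 * (poissonWeight 1 0 * aliveProb k 0)
      = ∑ y ∈ range (N + 1), aliveProb k y *
          ∑ i ∈ range (N + 1 - y), poissonWeight 1 i * h (y + i) := by
  have e : ∑ x ∈ range N, h (x + 1) * aliveProb (k + 1) x
        + h 0 * (poissonWeight 1 0 * aliveProb k 0)
      = ∑ z ∈ range (N + 1), ∑ i ∈ range (z + 1),
          poissonWeight 1 i * aliveProb k (z - i) * h z := by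
    rw [sum_range_succ']
    congr 1
    · refine sum_congr rfl fun x _ => ?_
      rw [aliveProb_succ, mul_sum]
      exact sum_congr rfl fun i _ => by ring
    · simp [mul_comm]
  rw [e, sum_sigma', sum_congr rfl fun y _ => mul_sum _ _ _, sum_sigma']
  refine sum_bij' (fun a _ => ⟨a.1 - a.2, a.2⟩) (fun b _ => ⟨b.1 + b.2, b.2⟩) ?_ ?_ ?_ ?_ ?_
  · rintro ⟨a, b⟩ h; simp at h ⊢; omega
  · rintro ⟨a, b⟩ h; simp at h ⊢; omega
  · rintro ⟨a, b⟩ h; simp at h ⊢; omega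
  · rintro ⟨a, b⟩ h; simp at h ⊢
  · rintro ⟨a, b⟩ h
    simp only [mem_sigma, mem_range] at h ⊢
    rw [Nat.sub_add_cancel (by omega)]
    ring

/-! ### From the probability space to the explicit law of the excursion at time `k`. -/

section Walk

variable {Ω : Type*}

lemma walk_zero (X : ℕ → Ω → ℕ) (ω : Ω) : walk X 0 ω = 0 := by simp [walk]

lemma walk_succ (X : ℕ → Ω → ℕ) (k : ℕ) (ω : Ω) :
    walk X (k + 1) ω = walk X k ω + X k ω - 1 := by
  rw [walk, sum_range_succ, walk]; ring

lemma walk_nonneg_of_forall_ne {X : ℕ → Ω → ℕ} {k : ℕ} {ω : Ω}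
    (h : ∀ j ≤ k, walk X j ω ≠ -1) : 0 ≤ walk X k ω := by
  induction k with
  | zero => simp [walk_zero]
  | succ k ih =>
    have h1 := ih fun j hj => h j (by omega)
    have h2 := h (k + 1) le_rfl
    rw [walk_succ] at h2 ⊢
    omega

lemma walk_le_walk_add (X : ℕ → Ω → ℕ) (k m : ℕ) (ω : Ω) :
    walk X k ω ≤ walk X (k + m) ω + m := by
  induction m with
  | zero => simp
  | succ m ih => rw [← add_assoc, walk_succ]; push_cast; omega

/-- The event that the walk is at `-1` for the first time at time `N`. -/
def firstHit (X : ℕ → Ω → ℕ) (N : ℕ) : Set Ω :=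
  {ω | walk X N ω = -1 ∧ ∀ j < N, walk X j ω ≠ -1}

open scoped Classical in
-- The search for a hit starts at time `1` in `hitTime` and at time `0` in `firstHit`; the two agree
-- because `S_0 = 0`.
lemma excursion_eq_firstHit (X : ℕ → Ω → ℕ) (n : ℕ) : excursion X n = firstHit X (n + 1) := by
  ext ω
  change (if ∃ j, 1 ≤ j ∧ walk X j ω ∈ ({-1} : Set ℤ) then
    ((sInf {i : ℕ | 1 ≤ i ∧ walk X i ω ∈ ({-1} : Set ℤ)} : ℕ) : WithTop ℕ) else ⊤)
      = ((n + 1 : ℕ) : WithTop ℕ) ↔ walk X (n + 1) ω = -1 ∧ ∀ j < n + 1, walk X j ω ≠ -1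
  constructor
  · intro h
    by_cases hex : ∃ j, 1 ≤ j ∧ walk X j ω ∈ ({-1} : Set ℤ)
    swap
    · rw [if_neg hex] at h
      exact absurd h.symm (WithTop.coe_ne_top)
    rw [if_pos hex] at h
    have hne : {i : ℕ | 1 ≤ i ∧ walk X i ω ∈ ({-1} : Set ℤ)}.Nonempty := hex
    have hs : sInf {i : ℕ | 1 ≤ i ∧ walk X i ω ∈ ({-1} : Set ℤ)} = n + 1 :=
      WithTop.coe_injective h
    have hm := Nat.sInf_mem hne
    rw [hs] at hm
    refine ⟨hm.2, fun j hj hw => ?_⟩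
    rcases Nat.eq_zero_or_pos j with rfl | hj0
    · simp [walk_zero] at hw
    · have := Nat.sInf_le
        (show j ∈ {i : ℕ | 1 ≤ i ∧ walk X i ω ∈ ({-1} : Set ℤ)} from ⟨hj0, hw⟩)
      omega
  · rintro ⟨h1, h2⟩
    rw [if_pos ⟨n + 1, by omega, h1⟩]
    have : sInf {i : ℕ | 1 ≤ i ∧ walk X i ω ∈ ({-1} : Set ℤ)} = n + 1 := by
      refine le_antisymm (Nat.sInf_le ⟨by omega, h1⟩) ?_
      refine le_csInf ⟨n + 1, by omega, h1⟩ fun j hj => ?_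
      by_contra hlt
      exact h2 j (by omega) hj.2
    rw [this]

/-- The `σ`-algebra generated by the first `k` steps. -/
@[reducible] def past (X : ℕ → Ω → ℕ) (k : ℕ) : MeasurableSpace Ω :=
  ⨆ i ∈ {i : ℕ | i < k}, MeasurableSpace.comap (X i) ⊤

lemma past_mono (X : ℕ → Ω → ℕ) {k l : ℕ} (h : k ≤ l) : past X k ≤ past X l :=
  biSup_mono fun _ hi => lt_of_lt_of_le hi h

lemma measurable_past (X : ℕ → Ω → ℕ) {i k : ℕ} (h : i < k) : Measurable[past X k] (X i) := by
  refine Measurable.mono (comap_measurable (X i)) ?_ le_rfl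
  exact le_biSup (fun i => MeasurableSpace.comap (X i) ⊤) (show i ∈ {i : ℕ | i < k} from h)

lemma measurable_walk_past (X : ℕ → Ω → ℕ) {j k : ℕ} (h : j ≤ k) :
    Measurable[past X k] (walk X j) := by
  unfold walk
  refine @Finset.measurable_fun_sum _ _ _ _ _ _ (past X k) _ _ fun i hi => ?_
  have hi' : Measurable[past X k] (X i) := measurable_past X (by simp at hi; omega)
  exact (measurable_from_top (f := fun n : ℕ => (n : ℤ) - 1)).comp hi'

/-- The event that the walk has not visited `-1` before time `k` and is at `x` at time `k`. -/
def aliveAt (X : ℕ → Ω → ℕ) (k : ℕ) (x : ℤ) : Set Ω :=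
  {ω | walk X k ω = x ∧ ∀ j < k, walk X j ω ≠ -1}

lemma measurableSet_aliveAt_past (X : ℕ → Ω → ℕ) (k : ℕ) (x : ℤ) :
    MeasurableSet[past X k] (aliveAt X k x) := by
  have e : aliveAt X k x = walk X k ⁻¹' {x} ∩ ⋂ j ∈ {j : ℕ | j < k}, walk X j ⁻¹' {-1}ᶜ := by
    ext ω; simp [aliveAt]
  rw [e]
  refine MeasurableSet.inter (measurable_walk_past X le_rfl (measurableSet_singleton _)) ?_
  exact MeasurableSet.biInter (Set.to_countable _) fun j hj =>
    measurable_walk_past X (le_of_lt hj) (measurableSet_singleton _).compl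

lemma walk_mem_of_mem_excursion {n k : ℕ} {X : ℕ → Ω → ℕ} (hk : k ≤ n) {ω : Ω}
    (h : ω ∈ excursion X n) :
    ∃ x ∈ range (n + 1), walk X k ω = x := by
  rw [excursion_eq_firstHit] at h
  have h1 := walk_nonneg_of_forall_ne fun j (hj : j ≤ k) => h.2 j (by omega)
  have h2 := walk_le_walk_add X k (n + 1 - k) ω
  rw [show k + (n + 1 - k) = n + 1 by omega, h.1] at h2
  obtain ⟨x, hx⟩ := Int.eq_ofNat_of_zero_le h1
  refine ⟨x, mem_range.2 ?_, hx⟩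
  omega

variable [MeasurableSpace Ω] {P : Measure Ω} {X : ℕ → Ω → ℕ}

lemma past_le (hX : ∀ i, Measurable (X i)) (k : ℕ) : past X k ≤ ‹MeasurableSpace Ω› :=
  iSup₂_le fun i _ => (hX i).comap_le

lemma measureReal_inter_step (hX : ∀ i, Measurable (X i)) (hind : iIndepFun X P)
    (hlaw : ∀ i, P.map (X i) = poissonMeasure 1) {k : ℕ} {B : Set Ω}
    (hB : MeasurableSet[past X k] B) (i : ℕ) :
    P.real (B ∩ X k ⁻¹' {i}) = P.real B * poissonWeight 1 i := by
  have hi : Indep (past X k) (⨆ j ∈ ({k} : Set ℕ), MeasurableSpace.comap (X j) ⊤) P :=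
    indep_iSup_of_disjoint (fun j => (hX j).comap_le) hind (by simp)
  have hm : MeasurableSet[⨆ j ∈ ({k} : Set ℕ), MeasurableSpace.comap (X j) ⊤] (X k ⁻¹' {i}) := by
    rw [_root_.iSup_singleton]
    exact ⟨{i}, trivial, rfl⟩
  have hlaw' : P.real (X k ⁻¹' {i}) = poissonWeight 1 i := by
    rw [← map_measureReal_apply (hX k) (measurableSet_singleton i), hlaw,
      poissonMeasure_real_singleton]
    simp [poissonWeight]
  rw [measureReal_def, (Indep_iff _ _ _).1 hi _ _ hB hm, ENNReal.toReal_mul, ← measureReal_def,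
    ← measureReal_def, hlaw']

variable [IsProbabilityMeasure P]

lemma hasSum_measureReal_inter_step (hX : ∀ i, Measurable (X i)) (k : ℕ) (S : Set Ω)
    (hS : MeasurableSet S) : HasSum (fun i => P.real (S ∩ X k ⁻¹' {i})) (P.real S) := by
  have hU : S = ⋃ i, S ∩ X k ⁻¹' {i} := by ext ω; simp
  have hd : Pairwise (Function.onFun Disjoint fun i => S ∩ X k ⁻¹' {i}) := by
    intro i j hij
    rw [Function.onFun, Set.disjoint_left]
    rintro ω ⟨-, h1⟩ ⟨-, h2⟩
    exact hij (h1.symm.trans h2)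
  have hm : ∀ i, MeasurableSet (S ∩ X k ⁻¹' {i}) := fun i =>
    hS.inter (hX k (measurableSet_singleton i))
  have h : P S = ∑' i, P (S ∩ X k ⁻¹' {i}) := by
    rw [← measure_iUnion hd hm, ← hU]
  have hs := ENNReal.hasSum_toReal (h ▸ measure_ne_top P S)
  rwa [← ENNReal.tsum_toReal_eq fun i => measure_ne_top P _, ← h] at hs

lemma measurableSet_firstHit (hX : ∀ i, Measurable (X i)) (N : ℕ) :
    MeasurableSet (firstHit X N) :=
  -- `firstHit X N` is `aliveAt X N (-1)` by definition.
  past_le hX N _ (measurableSet_aliveAt_past X N (-1))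

/-- The Markov property and the Kemperman formula. -/
lemma measureReal_inter_firstHit (hX : ∀ i, Measurable (X i)) (hind : iIndepFun X P)
    (hlaw : ∀ i, P.map (X i) = poissonMeasure 1) (m : ℕ) {k y : ℕ} {B : Set Ω}
    (hB : MeasurableSet[past X k] B) (hsub : B ⊆ aliveAt X k ((y : ℤ) - 1)) :
    P.real (B ∩ firstHit X (k + m)) = P.real B * hitProb m y := by
  induction m generalizing k y B with
  | zero =>
    rcases Nat.eq_zero_or_pos y with rfl | hy
    · rw [Set.inter_eq_left.2 fun ω hω => ?_]
      · simp [hitProb]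
      · have := hsub hω
        simpa [firstHit, aliveAt] using this
    · rw [hitProb_eq_zero hy, mul_zero]
      convert measureReal_empty using 2
      ext ω
      simp only [Set.mem_inter_iff, Set.mem_empty_iff_false, iff_false, not_and]
      intro h1 h2
      have h3 := (hsub h1).1
      have h4 := h2.1
      simp only [add_zero] at h4
      omega
  | succ m ih =>
    rcases y with _ | y
    · rw [hitProb_zero_right, if_neg (by omega), mul_zero]
      convert measureReal_empty using 2
      ext ω
      simp only [Set.mem_inter_iff, Set.mem_empty_iff_false, iff_false, not_and]
      intro h1 h2
      have h3 := (hsub h1).1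
      exact h2.2 k (by omega) (by simpa using h3)
    -- Condition on the step `X k = i`: it moves the distance to `-1` from `y + 1` to `y + i`, and
    -- the induction hypothesis applies to `B ∩ {X k = i}`, which belongs to the past at time `k +
    -- 1`.
    · refine (hasSum_measureReal_inter_step hX k _ ((past_le hX k _ hB).inter
        (measurableSet_firstHit hX _))).unique ?_
      have hsum := (hasSum_hitProb m y).mul_left (P.real B)
      refine (funext fun i => ?_ : (fun i => P.real (B ∩ firstHit X (k + (m + 1)) ∩ X k ⁻¹' {i})) =
        fun i => P.real B * (poissonWeight 1 i * hitProb m (y + i))) ▸ hsum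
      rw [Set.inter_right_comm, ← mul_assoc, ← measureReal_inter_step hX hind hlaw hB i,
        show k + (m + 1) = k + 1 + m by omega]
      refine ih ?_ ?_
      · exact MeasurableSet.inter (past_mono X (Nat.le_succ k) _ hB)
          (measurable_past X (Nat.lt_succ_self k) (measurableSet_singleton i))
      · rintro ω ⟨h1, h2⟩
        obtain ⟨h3, h4⟩ := hsub h1
        have h2' : X k ω = i := h2
        refine ⟨?_, fun j hj => ?_⟩
        · rw [walk_succ, h3, h2']; push_cast; ring
        · rcases Nat.lt_succ_iff_lt_or_eq.1 hj with hj | rfl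
          · exact h4 j hj
          · rw [h3]; push_cast; omega

lemma measureReal_aliveAt (hX : ∀ i, Measurable (X i)) (hind : iIndepFun X P)
    (hlaw : ∀ i, P.map (X i) = poissonMeasure 1) (k x : ℕ) :
    P.real (aliveAt X k x) = aliveProb k x := by
  induction k generalizing x with
  | zero =>
    by_cases hx : x = 0
    · have : aliveAt X 0 x = Set.univ := by ext ω; simp [aliveAt, walk_zero, hx]
      rw [this]
      simp [aliveProb, hx]
    · have : aliveAt X 0 x = ∅ := by ext ω; simp [aliveAt, walk_zero]; omega
      simp [this, aliveProb, hx]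
  | succ k ih =>
    refine (hasSum_measureReal_inter_step hX k _ (past_le hX _ _
      (measurableSet_aliveAt_past X (k + 1) x))).unique ?_
    rw [aliveProb_succ]
    refine (sum_congr rfl fun i hi => ?_ : ∑ i ∈ range (x + 2), P.real
      (aliveAt X (k + 1) x ∩ X k ⁻¹' {i}) = _) ▸ hasSum_sum_of_ne_finset_zero fun i hi => ?_
    · have hi' := mem_range.1 hi
      rw [mul_comm, ← ih, ← measureReal_inter_step hX hind hlaw
        (measurableSet_aliveAt_past X k _)]
      congr 1
      ext ω
      simp only [aliveAt, Set.mem_inter_iff, Set.mem_ofPred_eq, Set.mem_preimage,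
        Set.mem_singleton_iff]
      constructor
      · rintro ⟨⟨h1, h2⟩, h3⟩
        rw [walk_succ] at h1
        exact ⟨⟨by omega, fun j hj => h2 j (by omega)⟩, h3⟩
      · rintro ⟨⟨h1, h2⟩, h3⟩
        refine ⟨⟨by rw [walk_succ]; omega, fun j hj => ?_⟩, h3⟩
        rcases Nat.lt_succ_iff_lt_or_eq.1 hj with hj | rfl
        · exact h2 j hj
        · omega
    -- A step `i > x + 1` would have to start below `0`, impossible for a walk that has avoided
    -- `-1`.
    · convert measureReal_empty using 2
      ext ω
      simp only [aliveAt, Set.mem_inter_iff, Set.mem_ofPred_eq, Set.mem_preimage,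
        Set.mem_singleton_iff, Set.mem_empty_iff_false, iff_false, not_and]
      rintro ⟨h1, h2⟩ h3
      have h4 := walk_nonneg_of_forall_ne fun j (hj : j ≤ k) => h2 j (by omega)
      rw [walk_succ] at h1
      simp at hi
      omega

lemma measureReal_excursion (hX : ∀ i, Measurable (X i)) (hind : iIndepFun X P)
    (hlaw : ∀ i, P.map (X i) = poissonMeasure 1) (n : ℕ) :
    P.real (excursion X n) = hitProb (n + 1) 1 := by
  have h := measureReal_inter_firstHit hX hind hlaw (n + 1) (k := 0) (y := 1) (B := Set.univ)
    MeasurableSet.univ (fun ω _ => by simp [aliveAt, walk_zero])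
  rw [Set.univ_inter, zero_add] at h
  rw [excursion_eq_firstHit, h]
  simp

lemma measureReal_excursion_inter (hX : ∀ i, Measurable (X i)) (hind : iIndepFun X P)
    (hlaw : ∀ i, P.map (X i) = poissonMeasure 1) {n k : ℕ} (hk : k ≤ n) (x : ℕ) :
    P.real (excursion X n ∩ walk X k ⁻¹' {(x : ℤ)}) = aliveProb k x * hitProb (n + 1 - k) (x + 1) := by
  rw [← measureReal_aliveAt hX hind hlaw, ← measureReal_inter_firstHit hX hind hlaw (n + 1 - k)
    (measurableSet_aliveAt_past X k x) (fun ω h => by simpa using h), excursion_eq_firstHit,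
    show k + (n + 1 - k) = n + 1 by omega]
  congr 1
  ext ω
  simp only [firstHit, aliveAt, Set.mem_inter_iff, Set.mem_ofPred_eq, Set.mem_preimage,
    Set.mem_singleton_iff]
  constructor
  · rintro ⟨⟨h1, h2⟩, h3⟩
    exact ⟨⟨h3, fun j hj => h2 j (by omega)⟩, h1, h2⟩
  · rintro ⟨⟨h3, -⟩, h1⟩
    exact ⟨h1, h3⟩

/-- The law of the excursion at time `k`. -/
lemma moment_eq (hX : ∀ i, Measurable (X i)) (hind : iIndepFun X P)
    (hlaw : ∀ i, P.map (X i) = poissonMeasure 1) {n k : ℕ} (hk : k ≤ n) (d : ℝ) :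
    Integrable (fun ω => (walk X k ω : ℝ) ^ d) (excursionMeasure P X n) ∧
    excursionMoment P X n k d = ∑ x ∈ range (n + 1), (x : ℝ) ^ d *
      (aliveProb k x * hitProb (n + 1 - k) (x + 1) / hitProb (n + 1) 1) := by
  have hE : MeasurableSet (excursion X n) := by
    rw [excursion_eq_firstHit]; exact measurableSet_firstHit hX _
  have hW : ∀ x : ℤ, MeasurableSet (walk X k ⁻¹' {x}) := fun x =>
    past_le hX k _ (measurable_walk_past X le_rfl (measurableSet_singleton x))
  have hae : (fun ω => (walk X k ω : ℝ) ^ d) =ᵐ[excursionMeasure P X n]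
      fun ω => ∑ x ∈ range (n + 1), (walk X k ⁻¹' {(x : ℤ)}).indicator
        (fun _ => (x : ℝ) ^ d) ω := by
    refine ae_cond_of_forall_mem hE fun ω hω => ?_
    beta_reduce
    obtain ⟨x, hx, hxe⟩ := walk_mem_of_mem_excursion hk hω
    rw [sum_eq_single_of_mem x hx fun y _ hy => ?_]
    · simp [hxe]
    · refine Set.indicator_of_notMem ?_ _
      simp only [Set.mem_preimage, Set.mem_singleton_iff, hxe]
      exact_mod_cast hy.symm
  have : IsFiniteMeasure (excursionMeasure P X n) := by unfold excursionMeasure; infer_instance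
  have hint : ∀ x ∈ range (n + 1), Integrable ((walk X k ⁻¹' {(x : ℤ)}).indicator
        (fun _ => (x : ℝ) ^ d)) (excursionMeasure P X n) := fun x _ =>
    (integrable_const _).indicator (hW x)
  refine ⟨(integrable_congr hae).2 (integrable_finsetSum _ hint), ?_⟩
  rw [excursionMoment, integral_congr_ae hae, integral_finsetSum _ hint]
  refine sum_congr rfl fun x _ => ?_
  rw [integral_indicator_const _ (hW x), excursionMeasure, measureReal_def, cond_apply hE,
    ENNReal.toReal_mul, ENNReal.toReal_inv, ← measureReal_def, ← measureReal_def,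
    measureReal_excursion hX hind hlaw, measureReal_excursion_inter hX hind hlaw hk, smul_eq_mul]
  ring

end Walk

/-! ### Stirling and Gaussian estimates for the hitting probabilities. -/

lemma poissonWeight_le_self (b r : ℕ) : poissonWeight b r ≤ poissonWeight b b := by
  rcases le_total r b with h | h
  · induction h using Nat.decreasingInduction with
    | self => exact le_rfl
    | of_succ r hr ih =>
      refine le_trans ?_ ih
      rw [poissonWeight_succ, mul_div_assoc]
      refine le_mul_of_one_le_right (poissonWeight_nonneg _ _) ?_
      rw [one_le_div (by positivity)]
      exact_mod_cast hr
  · induction r, h using Nat.le_induction with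
    | base => exact le_rfl
    | succ r hr ih =>
      refine le_trans ?_ ih
      rw [poissonWeight_succ, mul_div_assoc]
      refine mul_le_of_le_one_right (poissonWeight_nonneg _ _) ?_
      rw [div_le_one (by positivity)]
      exact_mod_cast hr.trans (Nat.le_succ r)

lemma poissonWeight_self_eq (b : ℕ) :
    poissonWeight b b = ((b : ℝ) / Real.exp 1) ^ b / b ! := by
  rw [poissonWeight, div_pow, ← Real.exp_nat_mul, mul_one, Real.exp_neg]
  ring

lemma poissonWeight_self_le {b : ℕ} (hb : 1 ≤ b) : poissonWeight b b ≤ 1 / √(b : ℝ) := by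
  have hb' : (0 : ℝ) < b := by exact_mod_cast hb
  rw [poissonWeight_self_eq, div_le_div_iff₀ (by positivity) (by positivity), one_mul]
  refine le_trans ?_ (Stirling.le_factorial_stirling b)
  rw [mul_comm]
  gcongr
  have := Real.pi_gt_three
  nlinarith

/-- The Stirling sequence decreases, so it stays below its first value `e / √2`. -/
lemma le_poissonWeight_self {b : ℕ} (hb : 1 ≤ b) :
    Real.exp (-1) / √(b : ℝ) ≤ poissonWeight b b := by
  obtain ⟨n, rfl⟩ := Nat.exists_eq_add_of_le' hb
  have h := Stirling.stirlingSeq'_antitone (Nat.zero_le n)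
  simp only [Function.comp, Nat.succ_eq_add_one, zero_add, Stirling.stirlingSeq_one] at h
  rw [Stirling.stirlingSeq, Real.sqrt_mul (by norm_num)] at h
  rw [poissonWeight_self_eq, Real.exp_neg]
  have h1 : 0 < √((n + 1 : ℕ) : ℝ) := by positivity
  have h2 : 0 < √(2 : ℝ) := by positivity
  have h3 : 0 < (((n + 1 : ℕ) : ℝ) / Real.exp 1) ^ (n + 1) := by positivity
  rw [div_le_div_iff₀ (by positivity) h2] at h
  rw [div_le_div_iff₀ h1 (by positivity), inv_mul_le_iff₀ (Real.exp_pos _)]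
  have := le_of_mul_le_mul_right (h.trans_eq (by ring :
    _ = Real.exp 1 * (√((n + 1 : ℕ) : ℝ) * (((n + 1 : ℕ) : ℝ) / Real.exp 1) ^ (n + 1)) * √2)) h2
  linarith

/-- The ratio to the central weight is the product of `1 - j / m` over `j < y`, and each factor is
at most `exp (-j / m)`. -/
lemma poissonWeight_sub_le {m y : ℕ} (hm : 1 ≤ m) (hy : y ≤ m) :
    poissonWeight m (m - y) ≤ poissonWeight m m * Real.exp (-(y * (y - 1) / (2 * m))) := by
  have hm' : (0 : ℝ) < m := by exact_mod_cast hm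
  induction y with
  | zero => simp
  | succ y ih =>
    obtain ⟨r, hr⟩ := Nat.exists_eq_add_of_le' hy
    have h1 := poissonWeight_succ m r
    have hry : (r : ℝ) + 1 = m - y := by
      have : (m : ℝ) = (r + (y + 1) : ℕ) := by rw [← hr]
      push_cast at this; linarith
    rw [show m - (y + 1) = r by omega]
    have h2 : poissonWeight m r = poissonWeight m (m - y) * (1 - y / m) := by
      rw [show m - y = r + 1 by omega, h1, hry]
      have : (m : ℝ) - y ≠ 0 := by rw [← hry]; positivity
      field_simp
    rw [h2]
    have h3 : (1 : ℝ) - y / m ≤ Real.exp (-(y / m)) := Real.one_sub_le_exp_neg _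
    refine (mul_le_mul_of_nonneg_left h3 (poissonWeight_nonneg _ _)).trans ?_
    refine (mul_le_mul_of_nonneg_right (ih (by omega)) (Real.exp_pos _).le).trans_eq ?_
    rw [mul_assoc, ← Real.exp_add]
    congr 2
    push_cast
    field_simp
    ring

lemma hitProb_le {m : ℕ} (hm : 1 ≤ m) (x : ℕ) :
    hitProb m (x + 1) ≤ (x + 1) / (m * √(m : ℝ)) * Real.exp (-(x ^ 2 / (2 * m))) := by
  have hm' : (0 : ℝ) < m := by exact_mod_cast hm
  by_cases hx : x + 1 ≤ m
  swap
  · rw [hitProb_eq_zero (by omega)]; positivity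
  obtain ⟨M, rfl⟩ := Nat.exists_eq_add_of_le' hm
  rw [hitProb, if_pos hx]
  have h1 := (poissonWeight_sub_le hm hx).trans
    (mul_le_mul_of_nonneg_right (poissonWeight_self_le hm) (Real.exp_pos _).le)
  have h2 : Real.exp (-(((x + 1 : ℕ) : ℝ) * (((x + 1 : ℕ) : ℝ) - 1) / (2 * ((M + 1 : ℕ) : ℝ))))
      ≤ Real.exp (-((x : ℝ) ^ 2 / (2 * ((M + 1 : ℕ) : ℝ)))) := by
    gcongr
    push_cast
    nlinarith [(Nat.cast_nonneg x : (0 : ℝ) ≤ x)]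
  have h3 := h1.trans (mul_le_mul_of_nonneg_left h2 (by positivity))
  refine (mul_le_mul_of_nonneg_left h3 (by positivity)).trans_eq ?_
  push_cast
  field_simp

lemma le_hitProb_one (n : ℕ) :
    Real.exp (-1) / ((n + 1 : ℝ) * √(n + 1 : ℝ)) ≤ hitProb (n + 1) 1 := by
  rw [hitProb, if_pos (by omega), Nat.add_sub_cancel]
  have h := le_poissonWeight_self (b := n + 1) (by omega)
  rw [poissonWeight_succ] at h
  push_cast at h ⊢
  rw [mul_div_cancel_right₀ _ (by positivity)] at h
  refine le_trans (le_of_eq ?_) (mul_le_mul_of_nonneg_left h (by positivity))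
  field_simp

/-! ### Mass and survival probability of the killed walk. -/

lemma sum_poissonWeight_one_le (M : ℕ) : ∑ i ∈ range M, poissonWeight 1 i ≤ 1 := by
  have h := hasSum_poissonWeight_one_mul_pow 1
  simp only [one_pow, mul_one, sub_self, Real.exp_zero] at h
  exact sum_le_hasSum _ (fun i _ => poissonWeight_nonneg _ _) h

lemma sum_mul_poissonWeight_one_le (M : ℕ) :
    ∑ i ∈ range M, poissonWeight 1 i * (i : ℝ) ≤ 1 := by
  rcases M with _ | M
  · simp
  rw [sum_range_succ']
  refine le_trans (le_of_eq ?_) (sum_poissonWeight_one_le M)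
  simp only [Nat.cast_zero, mul_zero, add_zero]
  refine sum_congr rfl fun i _ => ?_
  rw [poissonWeight_succ]
  push_cast
  field_simp

/-- The steps are centred and `x + 1` vanishes at the killing point `-1`, so `x + 1` is harmonic for
the killed walk and its initial value is `1`. The inequality allows for truncation at `N`. -/
lemma sum_add_one_mul_aliveProb_le (k N : ℕ) :
    ∑ x ∈ range N, ((x : ℝ) + 1) * aliveProb k x ≤ 1 := by
  induction k generalizing N with
  | zero =>
    rcases N with _ | N
    · simp
    · rw [sum_range_succ', sum_eq_zero fun i _ => by simp [aliveProb]]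
      simp [aliveProb]
  | succ k ih =>
    have h := sum_mul_aliveProb_succ (fun z => (z : ℝ)) k N
    simp only [Nat.cast_zero, zero_mul, add_zero, Nat.cast_add, Nat.cast_one] at h
    rw [h]
    refine le_trans (sum_le_sum fun y _ => ?_) (ih (N + 1))
    rw [mul_comm]
    refine mul_le_mul_of_nonneg_right ?_ (aliveProb_nonneg _ _)
    simp only [mul_add, sum_add_distrib, ← sum_mul]
    refine add_le_add ?_ (sum_mul_poissonWeight_one_le _)
    exact mul_le_of_le_one_left (Nat.cast_nonneg _) (sum_poissonWeight_one_le _)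

lemma sum_aliveProb_mul_hitProb (k m N : ℕ) (hN : m + k ≤ N) :
    ∑ x ∈ range N, hitProb m (x + 1) * aliveProb k x = if m = 0 then 0 else hitProb (k + m) 1 := by
  rcases Nat.eq_zero_or_pos m with rfl | hm
  · rw [if_pos rfl]
    exact sum_eq_zero fun x _ => by rw [hitProb_eq_zero (by omega), zero_mul]
  rw [if_neg hm.ne']
  induction k generalizing m N with
  | zero =>
    rw [sum_eq_single_of_mem 0 (mem_range.2 (by omega)) fun x _ hx => by simp [aliveProb, hx]]
    simp [aliveProb]
  | succ k ih =>
    have h := sum_mul_aliveProb_succ (hitProb m) k N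
    rw [hitProb_zero_right, if_neg hm.ne', zero_mul, add_zero] at h
    rw [h, show k + 1 + m = k + (m + 1) by omega, ← ih (m + 1) (N + 1) (by omega) (by omega)]
    refine sum_congr rfl fun y hy => ?_
    rw [mul_comm]
    congr 1
    refine HasSum.unique (hasSum_sum_of_ne_finset_zero fun i hi => ?_) (hasSum_hitProb m y)
    rw [hitProb_eq_zero (by simp at hi hy; omega), mul_zero]

/-- Killing at time `k + 1` happens only from `0`, by a step down; this identifies the mass lost in
`sum_aliveProb_le`. -/
lemma poissonWeight_mul_aliveProb_zero (k : ℕ) :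
    poissonWeight 1 0 * aliveProb k 0 = hitProb (k + 1) 1 := by
  rw [← sum_aliveProb_mul_hitProb k 1 (k + 1) (by omega) |>.trans (if_neg one_ne_zero),
    sum_range_succ', sum_eq_zero fun x _ => by rw [hitProb_eq_zero (by omega), zero_mul]]
  simp [hitProb]

lemma sum_aliveProb_le (k N : ℕ) :
    ∑ x ∈ range N, aliveProb k x ≤ 1 - ∑ j ∈ range (k + 1), hitProb j 1 := by
  induction k generalizing N with
  | zero =>
    rcases N with _ | N
    · simp [hitProb]
    · rw [sum_range_succ', sum_eq_zero fun i _ => by simp [aliveProb]]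
      simp [aliveProb, hitProb]
  | succ k ih =>
    have h := sum_mul_aliveProb_succ (fun _ => 1) k N
    simp only [one_mul, mul_one, poissonWeight_mul_aliveProb_zero] at h
    rw [sum_range_succ]
    have h2 : ∑ y ∈ range (N + 1), aliveProb k y * ∑ i ∈ range (N + 1 - y), poissonWeight 1 i
        ≤ ∑ y ∈ range (N + 1), aliveProb k y := sum_le_sum fun y _ =>
      mul_le_of_le_one_right (aliveProb_nonneg _ _) (sum_poissonWeight_one_le _)
    have := ih (N + 1)
    linarith

lemma sum_aliveProb_le_one (k N : ℕ) : ∑ x ∈ range N, aliveProb k x ≤ 1 :=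
  (sum_aliveProb_le k N).trans (sub_le_self _ (sum_nonneg fun _ _ => hitProb_nonneg _ _))

lemma hasSum_poissonWeight_mul_exp (s : ℝ) :
    HasSum (fun i : ℕ => poissonWeight 1 i * Real.exp (s * i)) (Real.exp (Real.exp s - 1)) := by
  have h := hasSum_poissonWeight_one_mul_pow (Real.exp s)
  refine (funext fun i => ?_ : (fun i : ℕ => poissonWeight 1 i * Real.exp (s * i)) = _) ▸ h
  rw [← Real.exp_nat_mul, mul_comm s]

lemma hasSum_poissonWeight_one : HasSum (fun i : ℕ => poissonWeight 1 i) 1 := by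
  simpa using hasSum_poissonWeight_mul_exp 0

lemma sum_hitProb_step (j y : ℕ) :
    HasSum (fun i => poissonWeight 1 i * ∑ n ∈ range (j + 1), hitProb n (y + i))
      (∑ n ∈ range (j + 2), hitProb n (y + 1)) := by
  rw [sum_range_succ' _ (j + 1), hitProb_eq_zero (Nat.succ_pos y), add_zero]
  simp only [mul_sum]
  exact hasSum_sum fun n _ => hasSum_hitProb n y

/-- Optional stopping for `exp (-s Y_t - t a)`, `a = exp (-s) - 1 + s`, started at time `l - j` from
`y`: it is at most `1` if `0` is hit by time `l`, and at most `exp (-l a)` at time `l` otherwise. -/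
lemma le_sum_hitProb {s : ℝ} (hs : 0 ≤ s) {l j : ℕ} (hj : j ≤ l) (y : ℕ) :
    (1 - Real.exp (-(l * (Real.exp (-s) - 1 + s)))) * ∑ n ∈ range (j + 1), hitProb n y
      ≥ Real.exp (-((l - j) * (Real.exp (-s) - 1 + s)) - s * y)
        - Real.exp (-(l * (Real.exp (-s) - 1 + s))) := by
  set a := Real.exp (-s) - 1 + s with ha
  have ha0 : 0 ≤ a := by have := Real.add_one_le_exp (-s); linarith
  induction j generalizing y with
  | zero =>
    rcases y with _ | y
    · simp [hitProb]
      positivity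
    · simp only [zero_add, sum_range_one, hitProb_eq_zero (Nat.succ_pos y), mul_zero, ge_iff_le,
        sub_nonpos]
      apply Real.exp_le_exp.2
      push_cast
      nlinarith [mul_nonneg hs (by positivity : (0 : ℝ) ≤ y + 1)]
  | succ j ih =>
    have hlj : ((j + 1 : ℕ) : ℝ) ≤ l := by exact_mod_cast hj
    rcases y with _ | y
    · have : ∑ n ∈ range (j + 1 + 1), hitProb n 0 = 1 := by
        simp [hitProb_zero_right]
      rw [this, mul_one]
      simp only [Nat.cast_zero, mul_zero, sub_zero]
      refine sub_le_sub_right (Real.exp_le_one_iff.2 ?_) _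
      have := mul_nonneg (sub_nonneg.2 hlj) ha0
      linarith
    · have h1 := (sum_hitProb_step j y).mul_left (1 - Real.exp (-(l * a)))
      have h2 := ((hasSum_poissonWeight_mul_exp (-s)).mul_left
        (Real.exp (-((l - j) * a) - s * y))).sub
          (hasSum_poissonWeight_one.mul_right (Real.exp (-(l * a))))
      refine le_trans (le_of_eq ?_) (hasSum_le (fun i => ?_) h2 h1)
      · rw [← Real.exp_add, one_mul]
        congr 2
        push_cast
        rw [ha]; ring
      · have h3 := mul_le_mul_of_nonneg_left (ih (by omega) (y + i)) (poissonWeight_nonneg 1 i)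
        refine le_trans (le_of_eq ?_) (h3.trans_eq (by ring))
        rw [show -((l - j : ℝ) * a) - s * ((y + i : ℕ) : ℝ)
          = -((l - j) * a) - s * y + -s * i by push_cast; ring, Real.exp_add]
        ring

lemma abs_exp_sub_quadratic_le {s : ℝ} (h : |s| ≤ 1) :
    |Real.exp s - (1 + s + s ^ 2 / 2)| ≤ |s| ^ 3 * (2 / 9) := by
  have := Real.exp_bound h (n := 3) (by norm_num)
  norm_num [sum_range_succ, Nat.factorial] at this ⊢
  exact this

lemma sum_aliveProb_le_div_sqrt {k : ℕ} (hk : 1 ≤ k) (N : ℕ) :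
    ∑ x ∈ range N, aliveProb k x ≤ 5 / √(k : ℝ) := by
  have hk' : (1 : ℝ) ≤ k := by exact_mod_cast hk
  refine (sum_aliveProb_le k N).trans ?_
  set D := ∑ j ∈ range (k + 1), hitProb j 1
  -- At this scale `k a ≥ 1/4`, so `1 - exp (-k a) ≥ 1/5`, while the starting value `exp (-s)` is
  -- within `s` of `1`: hence the constant `5`.
  set s := 1 / √(k : ℝ) with hs
  have hs0 : 0 < s := by positivity
  have hs1 : s ≤ 1 := by
    rw [hs, div_le_one (by positivity)]; exact Real.one_le_sqrt.2 hk'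
  have hks : (k : ℝ) * s ^ 2 = 1 := by
    rw [hs, div_pow, Real.sq_sqrt (by positivity)]; field_simp
  have h := le_sum_hitProb hs0.le (le_refl k) 1
  rw [sub_self, zero_mul, neg_zero, zero_sub, Nat.cast_one, mul_one] at h
  have hD : D ≤ 1 := by
    have := (sum_nonneg fun x _ => aliveProb_nonneg k x).trans (sum_aliveProb_le k 0)
    linarith
  have hq : s ^ 2 / 4 ≤ Real.exp (-s) - 1 + s := by
    have := (abs_le.1 (abs_exp_sub_quadratic_le (s := -s) (by rwa [abs_neg, abs_of_pos hs0]))).1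
    rw [abs_neg, abs_of_pos hs0] at this
    nlinarith [mul_nonneg (sq_nonneg s) (sub_nonneg.2 hs1)]
  have hc : Real.exp (-(k * (Real.exp (-s) - 1 + s))) ≤ 4 / 5 := by
    have h1 : (1 : ℝ) / 4 ≤ k * (Real.exp (-s) - 1 + s) := by nlinarith
    have h2 := Real.add_one_le_exp (k * (Real.exp (-s) - 1 + s))
    rw [Real.exp_neg, inv_le_comm₀ (Real.exp_pos _) (by norm_num)]
    linarith
  have he := Real.add_one_le_exp (-s)
  have : 1 - D ≤ 5 * s := by nlinarith
  rw [hs] at this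
  linarith [mul_one_div 5 √(k : ℝ)]

/-! ### Survival of the time-reversed walk, which can jump over the boundary. -/

lemma poissonWeight_one_add_le (a i : ℕ) :
    poissonWeight 1 (i + a) ≤ poissonWeight 1 a * (1 / i !) := by
  rw [poissonWeight_one, poissonWeight_one, div_mul_div_comm, mul_one]
  gcongr
  exact_mod_cast (mul_comm _ _).trans_le
    (Nat.le_of_dvd (Nat.factorial_pos _) (Nat.factorial_mul_factorial_dvd_factorial_add i a))

/-- The overshoot of a Poisson step above a level has uniformly bounded exponential moments. -/
lemma sum_poissonWeight_mul_sub_le {s t : ℝ} (hs : 0 ≤ s) (ht : t ≤ 1) (a : ℕ) :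
    ∑ i ∈ range a, poissonWeight 1 i *
        (1 + (Real.exp (Real.exp s) - Real.exp 1) - t * Real.exp (s * (i - a)))
      ≤ 1 + (Real.exp (Real.exp s) - Real.exp 1)
        - t * Real.exp (-(s * a)) * Real.exp (Real.exp s - 1) := by
  set κ := Real.exp (Real.exp s) - Real.exp 1 with hκ
  have hκ0 : 0 ≤ κ := by
    rw [hκ, sub_nonneg]
    exact Real.exp_le_exp.2 (Real.one_le_exp hs)
  set F : ℕ → ℝ := fun i => poissonWeight 1 i * (1 + κ - t * Real.exp (s * (i - a))) with hF
  have h1 : HasSum F (1 + κ - t * Real.exp (-(s * a)) * Real.exp (Real.exp s - 1)) := by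
    have h := (hasSum_poissonWeight_one.mul_right (1 + κ)).sub
      ((hasSum_poissonWeight_mul_exp s).mul_left (t * Real.exp (-(s * a))))
    rw [one_mul] at h
    refine (funext fun i => ?_ : F = _) ▸ h
    simp only [hF]
    rw [show s * ((i : ℝ) - a) = -(s * a) + s * i by ring, Real.exp_add]
    ring
  have h2 := (hasSum_nat_add_iff' a).2 h1
  have hexp : ∀ u : ℝ, HasSum (fun i : ℕ => u ^ i / i !) (Real.exp u) := fun u => by
    rw [Real.exp_eq_exp_ℝ]; exact NormedSpace.expSeries_div_hasSum_exp u
  -- The tail `i ≥ a` must be shown nonnegative. It dominates this series, whose sum is exactly `0`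
  -- by the choice of `κ`: keep `κ` only at `i = a`, and bound the overshoot weights by `p a / i !`.
  have h3 := ((hasSum_ite_eq 0 κ).sub ((hexp (Real.exp s)).sub (hexp 1))).mul_left
    (poissonWeight 1 a)
  rw [← hκ, sub_self, mul_zero] at h3
  refine sub_nonneg.1 (hasSum_le (fun i => ?_) h3 h2)
  have hp := poissonWeight_one_add_le a i
  have hp0 := poissonWeight_nonneg 1 (i + a)
  have he : 1 ≤ Real.exp (s * i) := Real.one_le_exp (by positivity)
  have e1 : Real.exp s ^ i = Real.exp (s * i) := by rw [← Real.exp_nat_mul, mul_comm]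
  have e2 : s * (((i + a : ℕ) : ℝ) - a) = s * i := by push_cast; ring
  rw [hF, e1, one_pow]
  simp only [e2]
  have h4 : poissonWeight 1 (i + a) * (1 + κ - Real.exp (s * i)) ≤
      poissonWeight 1 (i + a) * (1 + κ - t * Real.exp (s * i)) := by
    gcongr
    exact mul_le_of_le_one_left (Real.exp_pos _).le ht
  refine le_trans ?_ h4
  have h5 : poissonWeight 1 (i + a) * (Real.exp (s * i) - 1)
      ≤ poissonWeight 1 a * (1 / i !) * (Real.exp (s * i) - 1) :=
    mul_le_mul_of_nonneg_right hp (by linarith)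
  have h6 : poissonWeight 1 a * (if i = 0 then κ else 0) ≤ poissonWeight 1 (i + a) * κ := by
    split_ifs with h
    · rw [h, zero_add]
    · rw [mul_zero]; positivity
  have e3 : poissonWeight 1 a * ((if i = 0 then κ else 0)
      - (Real.exp (s * i) / (i ! : ℝ) - 1 / (i ! : ℝ))) = poissonWeight 1 a * (if i = 0 then κ else 0)
        - poissonWeight 1 a * (1 / i !) * (Real.exp (s * i) - 1) := by ring
  rw [e3]
  nlinarith

/-- Optional stopping for `exp (-s (Y_t + 1) - t a)`, `a = exp s - 1 - s`, now with an overshoot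
below `-1` at death, whose exponential moment costs the extra `κ`. -/
lemma mul_dualAliveProb_le {s : ℝ} (hs : 0 ≤ s) {l j : ℕ} (hj : j ≤ l) (x : ℕ) :
    (1 + (Real.exp (Real.exp s) - Real.exp 1) - Real.exp (-(l * (Real.exp s - 1 - s))))
        * dualAliveProb j x
      ≤ 1 + (Real.exp (Real.exp s) - Real.exp 1)
        - Real.exp (-((l - j) * (Real.exp s - 1 - s)) - s * (x + 1)) := by
  set a := Real.exp s - 1 - s with ha
  have ha0 : 0 ≤ a := by have := Real.add_one_le_exp s; linarith
  set κ := Real.exp (Real.exp s) - Real.exp 1 with hκ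
  induction j generalizing x with
  | zero =>
    simp only [dualAliveProb, Function.iterate_zero, id, mul_one]
    refine sub_le_sub_left (Real.exp_le_exp.2 ?_) _
    push_cast
    nlinarith [mul_nonneg hs (by positivity : (0 : ℝ) ≤ x + 1)]
  | succ j ih =>
    have hlj : ((j + 1 : ℕ) : ℝ) ≤ l := by exact_mod_cast hj
    push_cast at hlj
    have ht : Real.exp (-((l - j) * a)) ≤ 1 :=
      Real.exp_le_one_iff.2 (by nlinarith)
    rw [dualAliveProb_succ, mul_sum]
    have h1 := sum_poissonWeight_mul_sub_le hs ht (x + 2)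
    rw [← hκ] at h1
    refine le_trans (sum_le_sum fun i hi => ?_) (h1.trans_eq ?_)
    · have hi' := mem_range.1 hi
      rw [mul_left_comm]
      refine mul_le_mul_of_nonneg_left ((ih (by omega) _).trans_eq ?_) (poissonWeight_nonneg _ _)
      rw [← Real.exp_add, Nat.cast_sub (by omega)]
      push_cast
      congr 2
      ring
    · rw [← Real.exp_add, ← Real.exp_add]
      congr 2
      push_cast
      rw [ha]; ring

/-- With `s = 1 / √l` the left factor is at least `1/3`, and the right side is at most `κ + s (x +
1)` with `κ = O(s)`. -/
lemma dualAliveProb_le {l : ℕ} (hl : 1 ≤ l) (x : ℕ) :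
    dualAliveProb l x ≤ 150 * (x + 1) / √(l : ℝ) := by
  have hl' : (1 : ℝ) ≤ l := by exact_mod_cast hl
  set s := 1 / √(l : ℝ) with hs
  have hs0 : 0 < s := by positivity
  have hs1 : s ≤ 1 := by
    rw [hs, div_le_one (by positivity)]; exact Real.one_le_sqrt.2 hl'
  have hls : (l : ℝ) * s ^ 2 = 1 := by
    rw [hs, div_pow, Real.sq_sqrt (by positivity)]; field_simp
  have h := mul_dualAliveProb_le hs0.le (le_refl l) x
  rw [sub_self, zero_mul, neg_zero, zero_sub] at h
  have hc : Real.exp (-(l * (Real.exp s - 1 - s))) ≤ 2 / 3 := by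
    have h1 : (1 : ℝ) / 2 ≤ l * (Real.exp s - 1 - s) := by
      have := Real.quadratic_le_exp_of_nonneg hs0.le
      nlinarith
    have h2 := Real.add_one_le_exp (l * (Real.exp s - 1 - s))
    rw [Real.exp_neg, inv_le_comm₀ (Real.exp_pos _) (by norm_num)]
    linarith
  have he := Real.add_one_le_exp (-(s * (x + 1)))
  have hκ : Real.exp (Real.exp s) - Real.exp 1 ≤ 42 * s := by
    have h1 : Real.exp s ≤ 1 + 2 * s := by
      have := (abs_le.1 (Real.abs_exp_sub_one_sub_id_le (abs_le.2 ⟨by linarith, hs1⟩))).2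
      nlinarith
    have h2 : Real.exp (Real.exp s) ≤ Real.exp 1 * Real.exp (2 * s) := by
      rw [← Real.exp_add]; exact Real.exp_le_exp.2 h1
    have h3 : Real.exp (2 * s) - 1 ≤ 2 * s * Real.exp (2 * s) := by
      have h4 := Real.add_one_le_exp (-(2 * s))
      have h5 : Real.exp (-(2 * s)) * Real.exp (2 * s) = 1 := by
        rw [← Real.exp_add, neg_add_cancel, Real.exp_zero]
      nlinarith [mul_le_mul_of_nonneg_right h4 (Real.exp_pos (2 * s)).le]
    have h6 : Real.exp (2 * s) ≤ Real.exp 1 ^ 2 := by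
      rw [← Real.exp_nat_mul]
      exact Real.exp_le_exp.2 (by push_cast; linarith)
    have h7 : Real.exp 1 ≤ 2.719 := Real.exp_one_lt_d9.le.trans (by norm_num)
    have h8 : 2 * s * Real.exp (2 * s) ≤ 2 * s * 2.719 ^ 2 := by
      gcongr
      exact h6.trans (by gcongr)
    calc Real.exp (Real.exp s) - Real.exp 1
        ≤ Real.exp 1 * (Real.exp (2 * s) - 1) := by linarith
      _ ≤ 2.719 * (2 * s * 2.719 ^ 2) := by
          have h9 : 0 ≤ Real.exp (2 * s) - 1 := sub_nonneg.2 (Real.one_le_exp (by positivity))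
          exact mul_le_mul h7 (h3.trans h8) h9 (by norm_num)
      _ ≤ 42 * s := by norm_num; linarith
  have hκ0 : 0 ≤ Real.exp (Real.exp s) - Real.exp 1 :=
    sub_nonneg.2 (Real.exp_le_exp.2 (Real.one_le_exp hs0.le))
  have hv := dualAliveProb_nonneg l x
  have hx : (0 : ℝ) ≤ x := Nat.cast_nonneg x
  have : dualAliveProb l x ≤ 150 * (x + 1) * s := by
    have h5 : 1 / 3 * dualAliveProb l x ≤ 42 * s + s * (x + 1) := by nlinarith
    nlinarith
  rwa [hs, mul_one_div] at this

/-! ### The pointwise bound on the killed walk. -/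

lemma aliveProb_add_le_mul_dualAliveProb {a : ℕ} {M : ℝ} (h : ∀ w, aliveProb a w ≤ M) (c x : ℕ) :
    aliveProb (a + c) x ≤ M * dualAliveProb c x := by
  induction c generalizing x with
  | zero => simpa [dualAliveProb] using h x
  | succ c ih =>
    rw [← add_assoc, aliveProb_succ, dualAliveProb_succ, mul_sum]
    refine sum_le_sum fun i _ => ?_
    rw [mul_left_comm]
    exact mul_le_mul_of_nonneg_left (ih _) (poissonWeight_nonneg _ _)

/-- Killing is ignored during the last `b` steps, whose total jump is Poisson of parameter `b`. -/
lemma aliveProb_add_le_sum (a b x : ℕ) :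
    aliveProb (a + b) x ≤
      ∑ z ∈ range (x + b + 1), aliveProb a z * poissonWeight b (x + b - z) := by
  induction b generalizing x with
  | zero =>
    rw [add_zero, add_zero, sum_range_succ, Nat.sub_self]
    have : poissonWeight 0 0 = 1 := by simp [poissonWeight]
    rw [this, mul_one]
    exact le_add_of_nonneg_left (sum_nonneg fun _ _ =>
      mul_nonneg (aliveProb_nonneg _ _) (poissonWeight_nonneg _ _))
  | succ b ih =>
    rw [← add_assoc, aliveProb_succ]
    refine (sum_le_sum fun i _ =>
      mul_le_mul_of_nonneg_left (ih (x + 1 - i)) (poissonWeight_nonneg 1 i)).trans ?_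
    simp only [mul_sum]
    have e : ∑ i ∈ range (x + 2), ∑ z ∈ range (x + 1 - i + b + 1),
          poissonWeight 1 i * (aliveProb a z * poissonWeight b (x + 1 - i + b - z))
        ≤ ∑ i ∈ range (x + b + 2), ∑ z ∈ range (x + b + 2 - i),
          poissonWeight 1 i * (aliveProb a z * poissonWeight b (x + b + 1 - z - i)) := by
      refine le_trans (sum_le_sum fun i hi => le_of_eq ?_)
        (sum_le_sum_of_subset_of_nonneg (range_mono (by omega)) fun i _ _ =>
          sum_nonneg fun z _ => mul_nonneg (poissonWeight_nonneg _ _)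
            (mul_nonneg (aliveProb_nonneg _ _) (poissonWeight_nonneg _ _)))
      have hi' := mem_range.1 hi
      rw [show x + 1 - i + b + 1 = x + b + 2 - i by omega]
      refine sum_congr rfl fun z hz => ?_
      rw [show x + 1 - i + b - z = x + b + 1 - z - i by omega]
    refine e.trans (le_of_eq ?_)
    rw [sum_comm' (t' := range (x + b + 2)) (s' := fun z => range (x + b + 2 - z))
      (by intro i z; simp; omega)]
    rw [show x + (b + 1) + 1 = x + b + 2 by omega]
    refine sum_congr rfl fun z hz => ?_
    have hz' := mem_range.1 hz
    rw [show x + b + 2 - z = x + b + 1 - z + 1 by omega, show x + (b + 1) - z = x + b + 1 - z by omega,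
      ← sum_poissonWeight_mul, mul_sum]
    exact sum_congr rfl fun i _ => by ring

lemma aliveProb_le_one (m x : ℕ) : aliveProb m x ≤ 1 :=
  (single_le_sum (fun y _ => aliveProb_nonneg m y) (self_mem_range_succ x)).trans
    (sum_aliveProb_le_one m (x + 1))

lemma aliveProb_add_le {a b : ℕ} (ha : 1 ≤ a) (hb : 1 ≤ b) (x : ℕ) :
    aliveProb (a + b) x ≤ 5 / √(a : ℝ) * (1 / √(b : ℝ)) := by
  refine (aliveProb_add_le_sum a b x).trans ?_
  refine (sum_le_sum fun z _ => mul_le_mul_of_nonneg_left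
    ((poissonWeight_le_self _ _).trans (poissonWeight_self_le hb)) (aliveProb_nonneg a z)).trans ?_
  rw [← sum_mul]
  exact mul_le_mul_of_nonneg_right (sum_aliveProb_le_div_sqrt ha _) (by positivity)

lemma aliveProb_le {m : ℕ} (hm : 1 ≤ m) (x : ℕ) :
    aliveProb m x ≤ 12000 * (x + 1) / (m * √(m : ℝ)) := by
  have hm' : (1 : ℝ) ≤ m := by exact_mod_cast hm
  have hx : (0 : ℝ) ≤ x := Nat.cast_nonneg x
  have hsq : √(m : ℝ) ≤ m := by
    rw [Real.sqrt_le_left (by positivity)]; nlinarith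
  rcases lt_or_ge m 3 with h3 | h3
  · refine (aliveProb_le_one m x).trans ?_
    rw [le_div_iff₀ (by positivity)]
    have : (m : ℝ) ≤ 3 := by exact_mod_cast h3.le
    nlinarith
  · have ha : 1 ≤ m / 3 := by omega
    have hc : 1 ≤ m - 2 * (m / 3) := by omega
    have h1 := (aliveProb_add_le_mul_dualAliveProb (fun w => aliveProb_add_le ha ha w)
      (m - 2 * (m / 3)) x).trans (mul_le_mul_of_nonneg_left (dualAliveProb_le hc x) (by positivity))
    rw [show m / 3 + m / 3 + (m - 2 * (m / 3)) = m by omega] at h1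
    -- For `m ≥ 3` each of the three blocks has length at least `m / 5`, and `√5 ≤ 5 / 2`.
    have key : ∀ a : ℕ, m ≤ 5 * a → 1 / √(a : ℝ) ≤ 5 / 2 * (1 / √(m : ℝ)) := fun a ha => by
      have ha1 : 0 < a := by omega
      have ha' : (0 : ℝ) < a := by exact_mod_cast ha1
      have h5 : (m : ℝ) ≤ 5 * a := by exact_mod_cast ha
      rw [mul_one_div, div_le_div_iff₀ (by positivity) (by positivity), one_mul]
      refine Real.sqrt_le_iff.2 ⟨by positivity, ?_⟩
      rw [mul_pow, Real.sq_sqrt ha'.le]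
      linarith
    have k1 := key (m / 3) (by omega)
    have k2 := key (m - 2 * (m / 3)) (by omega)
    set A := 1 / √((m / 3 : ℕ) : ℝ)
    set B := 1 / √((m - 2 * (m / 3) : ℕ) : ℝ)
    set S := 1 / √(m : ℝ) with hS
    have hA : 0 ≤ A := by positivity
    have hB : 0 ≤ B := by positivity
    calc aliveProb m x ≤ 5 * A * A * (150 * (x + 1) * B) := by
          refine h1.trans_eq ?_
          simp only [A, B]; ring
      _ ≤ 5 * (5 / 2 * S) * (5 / 2 * S) * (150 * (x + 1) * (5 / 2 * S)) := by gcongr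
      _ ≤ 12000 * (x + 1) * (S * S * S) := by
          have : 0 ≤ (x + 1) * (S * S * S) := by positivity
          nlinarith
      _ = _ := by
          have : √(m : ℝ) * √(m : ℝ) = m := Real.mul_self_sqrt (by positivity)
          have hSS : S * S = 1 / m := by rw [hS, div_mul_div_comm, this, one_mul]
          rw [hSS, hS]
          field_simp

/-! ### Exponential moments of the killed walk. -/

/-- For symmetric steps `sinh` would be an exact eigenfunction; the asymmetry of the Poisson law
makes the growth rates at `s` and `-s` differ by `O(s ^ 3)`, whence the error term. -/
lemma sum_poissonWeight_mul_sinh_le {s : ℝ} (hs : 0 ≤ s) (hs1 : s ≤ 1) (y M : ℕ) :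
    ∑ i ∈ range M, poissonWeight 1 i * Real.sinh (s * ((y + i : ℕ) : ℝ))
      ≤ Real.exp (s ^ 2) * (Real.sinh (s * (y + 1)) + s ^ 3) := by
  have h := ((hasSum_poissonWeight_mul_exp s).mul_left (Real.exp (s * y) / 2)).sub
    ((hasSum_poissonWeight_mul_exp (-s)).mul_left (Real.exp (-(s * y)) / 2))
  have h1 : ∑ i ∈ range M, poissonWeight 1 i * Real.sinh (s * ((y + i : ℕ) : ℝ))
      ≤ Real.exp (s * y) / 2 * Real.exp (Real.exp s - 1)
        - Real.exp (-(s * y)) / 2 * Real.exp (Real.exp (-s) - 1) := by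
    have e : (fun i : ℕ => Real.exp (s * y) / 2 * (poissonWeight 1 i * Real.exp (s * i))
          - Real.exp (-(s * y)) / 2 * (poissonWeight 1 i * Real.exp (-s * i)))
        = fun i : ℕ => poissonWeight 1 i * Real.sinh (s * ((y + i : ℕ) : ℝ)) := by
      funext i
      rw [Real.sinh_eq, show s * ((y + i : ℕ) : ℝ) = s * y + s * i by push_cast; ring, neg_add,
        Real.exp_add, Real.exp_add, neg_mul]
      ring
    rw [e] at h
    exact sum_le_hasSum _ (fun i _ => mul_nonneg (poissonWeight_nonneg _ _)
      (Real.sinh_nonneg_iff.2 (by positivity))) h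
  refine h1.trans ?_
  have ha := abs_exp_sub_quadratic_le (s := s) (by rwa [abs_of_nonneg hs])
  have hb := abs_exp_sub_quadratic_le (s := -s) (by rwa [abs_neg, abs_of_nonneg hs])
  rw [abs_neg] at hb
  rw [abs_of_nonneg hs, abs_le] at ha hb
  set a := Real.exp s - 1 - s with had
  set b := Real.exp (-s) - 1 + s with hbd
  have e : Real.exp (s * y) / 2 * Real.exp (Real.exp s - 1)
        - Real.exp (-(s * y)) / 2 * Real.exp (Real.exp (-s) - 1)
      = Real.exp a * (Real.sinh (s * (y + 1))
        + Real.exp (-(s * (y + 1))) / 2 * (1 - Real.exp (b - a))) := by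
    have e1 : Real.exp (Real.exp s - 1) = Real.exp a * Real.exp s := by
      rw [← Real.exp_add, had]; ring_nf
    have e2 : Real.exp (Real.exp (-s) - 1) = Real.exp a * Real.exp (b - a) * Real.exp (-s) := by
      rw [← Real.exp_add, ← Real.exp_add, hbd]; ring_nf
    rw [e1, e2, Real.sinh_eq, show s * ((y : ℝ) + 1) = s * y + s by ring, neg_add, Real.exp_add (s * y),
      Real.exp_add (-(s * y))]
    ring
  rw [e]
  have hs3 : 0 ≤ s ^ 3 := by positivity
  have hs2 : 0 ≤ s ^ 2 := by positivity
  have hs32 : s ^ 3 ≤ s ^ 2 := by nlinarith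
  have h2 : 1 - Real.exp (b - a) ≤ s ^ 3 := by
    have := Real.add_one_le_exp (b - a)
    nlinarith
  have h3 : Real.exp (-(s * (y + 1))) ≤ 1 := Real.exp_le_one_iff.2 (by
    have : 0 ≤ s * ((y : ℝ) + 1) := by positivity
    linarith)
  have h4 : a ≤ s ^ 2 := by nlinarith
  have h5 : 0 ≤ Real.sinh (s * (y + 1)) := Real.sinh_nonneg_iff.2 (by positivity)
  refine mul_le_mul_of_nonneg_left ?_ (Real.exp_pos a).le |>.trans
    (mul_le_mul_of_nonneg_right (Real.exp_le_exp.2 h4) (by positivity))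
  refine add_le_add_right ?_ _
  have h6 := mul_le_mul_of_nonneg_left h2 (Real.exp_pos (-(s * ((y : ℝ) + 1)))).le
  nlinarith

lemma sum_sinh_mul_aliveProb_le {s : ℝ} (hs : 0 ≤ s) (hs1 : s ≤ 1) (k N : ℕ) :
    ∑ x ∈ range N, Real.sinh (s * ((x + 1 : ℕ) : ℝ)) * aliveProb k x
      ≤ Real.exp (k * s ^ 2) * (Real.sinh s + k * s ^ 3) := by
  induction k generalizing N with
  | zero =>
    have h0 : 0 ≤ Real.sinh s := Real.sinh_nonneg_iff.2 hs
    rcases N with _ | N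
    · simpa using h0
    · rw [sum_range_succ', sum_eq_zero fun i _ => by simp [aliveProb]]
      simp [aliveProb]
  | succ k ih =>
    have h := sum_mul_aliveProb_succ (fun z => Real.sinh (s * (z : ℝ))) k N
    simp only [Nat.cast_zero, mul_zero, Real.sinh_zero, zero_mul, add_zero] at h
    rw [h]
    have h1 : ∑ y ∈ range (N + 1), aliveProb k y *
          ∑ i ∈ range (N + 1 - y), poissonWeight 1 i * Real.sinh (s * ((y + i : ℕ) : ℝ))
        ≤ Real.exp (s ^ 2) * (∑ y ∈ range (N + 1), Real.sinh (s * ((y + 1 : ℕ) : ℝ)) * aliveProb k y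
          + s ^ 3 * ∑ y ∈ range (N + 1), aliveProb k y) := by
      rw [mul_sum, ← sum_add_distrib, mul_sum]
      refine sum_le_sum fun y _ => ?_
      refine (mul_le_mul_of_nonneg_left (sum_poissonWeight_mul_sinh_le hs hs1 y _)
        (aliveProb_nonneg k y)).trans_eq ?_
      push_cast
      ring
    refine h1.trans ?_
    have h2 := ih (N + 1)
    have h3 := mul_le_mul_of_nonneg_left (sum_aliveProb_le_one k (N + 1))
      (by positivity : 0 ≤ s ^ 3)
    have h4 : 1 ≤ Real.exp (k * s ^ 2) := Real.one_le_exp (by positivity)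
    have h5 : s ^ 3 ≤ Real.exp (k * s ^ 2) * s ^ 3 := le_mul_of_one_le_left (by positivity) h4
    have e : Real.exp (((k + 1 : ℕ) : ℝ) * s ^ 2) * (Real.sinh s + ((k + 1 : ℕ) : ℝ) * s ^ 3)
        = Real.exp (s ^ 2) * (Real.exp (k * s ^ 2) * (Real.sinh s + k * s ^ 3)
          + Real.exp (k * s ^ 2) * s ^ 3) := by
      rw [show ((k + 1 : ℕ) : ℝ) * s ^ 2 = s ^ 2 + k * s ^ 2 by push_cast; ring, Real.exp_add]
      push_cast
      ring
    rw [e]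
    exact mul_le_mul_of_nonneg_left (by linarith) (Real.exp_pos _).le

/-- The factor `1 / √k` is the point: `sinh` vanishes at the killing point, so survival is paid for.
A plain exponential started from `0` would only give a bounded sum. -/
lemma sum_sinh_div_sqrt_mul_aliveProb_le {k : ℕ} (hk : 1 ≤ k) (N : ℕ) :
    ∑ x ∈ range N, Real.sinh (1 / √(k : ℝ) * ((x + 1 : ℕ) : ℝ)) * aliveProb k x
      ≤ 9 * (1 / √(k : ℝ)) := by
  have hk' : (1 : ℝ) ≤ k := by exact_mod_cast hk
  set s := 1 / √(k : ℝ) with hs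
  have hs0 : 0 < s := by positivity
  have hs1 : s ≤ 1 := by
    rw [hs, div_le_one (by positivity)]; exact Real.one_le_sqrt.2 hk'
  have hks : (k : ℝ) * s ^ 2 = 1 := by
    rw [hs, div_pow, Real.sq_sqrt (by positivity)]; field_simp
  refine (sum_sinh_mul_aliveProb_le hs0.le hs1 k N).trans ?_
  have e : (k : ℝ) * s ^ 3 = s := by rw [pow_succ, ← mul_assoc, hks, one_mul]
  rw [hks, e]
  have ha := abs_exp_sub_quadratic_le (s := s) (by rwa [abs_of_nonneg hs0.le])
  have hb := abs_exp_sub_quadratic_le (s := -s) (by rwa [abs_neg, abs_of_nonneg hs0.le])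
  rw [abs_neg] at hb
  rw [abs_of_nonneg hs0.le, abs_le] at ha hb
  have h1 : Real.sinh s ≤ 2 * s := by
    rw [Real.sinh_eq]
    have : s ^ 3 ≤ s := by nlinarith [mul_nonneg hs0.le (sub_nonneg.2 hs1)]
    linarith
  have h7 : Real.exp 1 ≤ 3 := Real.exp_one_lt_d9.le.trans (by norm_num)
  calc Real.exp 1 * (Real.sinh s + s) ≤ 3 * (2 * s + s) := by gcongr
    _ = 9 * s := by ring

/-! ### Moment bounds for the explicit law. -/

/-- Raise `u ≤ exp u` to the power `p` at `u = c t / p`. This is the source of the growth in `d`: `d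
^ d` from exponential tails, `d ^ (d / 2)` from Gaussian tails, where `t = x ^ 2`. -/
lemma rpow_le_mul_exp {t p c : ℝ} (ht : 0 ≤ t) (hp : 0 < p) (hc : 0 < c) :
    t ^ p ≤ (p / c) ^ p * Real.exp (c * t) := by
  have h1 : c * t / p ≤ Real.exp (c * t / p) := by
    have := Real.add_one_le_exp (c * t / p); linarith
  have h2 := Real.rpow_le_rpow (by positivity) h1 hp.le
  rw [← Real.exp_mul, div_mul_cancel₀ _ hp.ne'] at h2
  calc t ^ p = (p / c) ^ p * (c * t / p) ^ p := by
        rw [← Real.mul_rpow (by positivity) (by positivity)]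
        congr 1
        field_simp
    _ ≤ _ := by gcongr

lemma self_rpow_le_mul_exp_sq {x d c : ℝ} (hx : 0 ≤ x) (hd : 0 < d) (hc : 0 < c) :
    x ^ d ≤ (d / (2 * c)) ^ (d / 2) * Real.exp (c * x ^ 2) := by
  have h := rpow_le_mul_exp (sq_nonneg x) (half_pos hd) hc
  have e : (x ^ 2) ^ (d / 2) = x ^ d := by
    rw [← Real.rpow_natCast, ← Real.rpow_mul hx, Nat.cast_ofNat, mul_div_cancel₀ _ two_ne_zero]
  rwa [e, div_div] at h

lemma mul_sqrt_eq_rpow {y : ℝ} (hy : 0 ≤ y) : y * √y = y ^ ((3 : ℝ) / 2) := by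
  rw [Real.sqrt_eq_rpow, show (3 : ℝ) / 2 = 1 + 1 / 2 by norm_num,
    Real.rpow_add_of_nonneg hy zero_le_one (by norm_num), Real.rpow_one]

/-- The moment of order `d` of the excursion of length `n + 1` at time `k`. -/
noncomputable def momentSum (n k : ℕ) (d : ℝ) : ℝ :=
  ∑ x ∈ range (n + 1), (x : ℝ) ^ d *
    (aliveProb k x * hitProb (n + 1 - k) (x + 1) / hitProb (n + 1) 1)

lemma hitProb_one_pos (n : ℕ) : 0 < hitProb (n + 1) 1 :=
  lt_of_lt_of_le (by positivity) (le_hitProb_one n)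

lemma hitProb_div_le {m : ℕ} (hm : 1 ≤ m) (n x : ℕ) :
    hitProb m (x + 1) / hitProb (n + 1) 1
      ≤ 3 * (((n : ℝ) + 1) / m) ^ ((3 : ℝ) / 2) * (x + 1) * Real.exp (-(x ^ 2 / (2 * m))) := by
  have hm' : (0 : ℝ) < m := by exact_mod_cast hm
  have h1 := hitProb_le hm x
  have h2 := le_hitProb_one n
  have h7 : Real.exp 1 ≤ 3 := Real.exp_one_lt_d9.le.trans (by norm_num)
  have h3 := one_div_le_one_div_of_le (by positivity) h2
  have e : 1 / (Real.exp (-1) / ((n + 1 : ℝ) * √(n + 1 : ℝ)))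
      = Real.exp 1 * ((n : ℝ) + 1) ^ ((3 : ℝ) / 2) := by
    rw [mul_sqrt_eq_rpow (by positivity), Real.exp_neg]
    field_simp
  rw [e] at h3
  rw [mul_sqrt_eq_rpow hm'.le] at h1
  rw [Real.div_rpow (by positivity) hm'.le, div_eq_mul_one_div]
  calc hitProb m (x + 1) * (1 / hitProb (n + 1) 1)
      ≤ ((x + 1) / (m : ℝ) ^ ((3 : ℝ) / 2) * Real.exp (-(x ^ 2 / (2 * m))))
          * (3 * ((n : ℝ) + 1) ^ ((3 : ℝ) / 2)) := by
        refine mul_le_mul h1 (h3.trans ?_) ?_ (by positivity)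
        · gcongr
        · exact (one_div_pos.2 (hitProb_one_pos n)).le
    _ = _ := by ring

lemma momentSum_term_le {n k : ℕ} (hk : k ≤ n) (d : ℝ) (x : ℕ) :
    (x : ℝ) ^ d * (aliveProb k x * hitProb (n + 1 - k) (x + 1) / hitProb (n + 1) 1)
      ≤ 3 * (((n : ℝ) + 1) / ((n + 1 - k : ℕ) : ℝ)) ^ ((3 : ℝ) / 2) *
        ((x : ℝ) ^ d * Real.exp (-(x ^ 2 / (2 * ((n + 1 - k : ℕ) : ℝ)))) *
          (((x : ℝ) + 1) * aliveProb k x)) := by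
  have h := hitProb_div_le (m := n + 1 - k) (by omega) n x
  rw [mul_div_assoc]
  calc _ ≤ (x : ℝ) ^ d * (aliveProb k x * _) := by
        refine mul_le_mul_of_nonneg_left (mul_le_mul_of_nonneg_left h (aliveProb_nonneg k x)) ?_
        positivity
    _ = _ := by ring

lemma momentSum_le_gaussian {n k : ℕ} (hk1 : 1 ≤ k) (hk : k ≤ n) {d : ℝ} (hd : 0 < d) :
    momentSum n k d ≤ 3 * (((n : ℝ) + 1) / ((n + 1 - k : ℕ) : ℝ)) ^ ((3 : ℝ) / 2) *
      (d * n) ^ (d / 2) := by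
  have hn : (0 : ℝ) < n := by exact_mod_cast (by omega : 0 < n)
  have hm0 : (0 : ℝ) < ((n + 1 - k : ℕ) : ℝ) := by exact_mod_cast (by omega : 0 < n + 1 - k)
  have hmn : ((n + 1 - k : ℕ) : ℝ) ≤ n := by exact_mod_cast (by omega : n + 1 - k ≤ n)
  refine (sum_le_sum fun x _ => momentSum_term_le hk d x).trans ?_
  rw [← mul_sum]
  refine mul_le_mul_of_nonneg_left ?_ (by positivity)
  have h1 : ∀ x : ℕ, (x : ℝ) ^ d * Real.exp (-(x ^ 2 / (2 * ((n + 1 - k : ℕ) : ℝ))))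
      ≤ (d * n) ^ (d / 2) := by
    intro x
    have h2 := self_rpow_le_mul_exp_sq (Nat.cast_nonneg x) hd (by positivity : 0 < 1 / (2 * (n : ℝ)))
    have e : d / (2 * (1 / (2 * (n : ℝ)))) = d * n := by field_simp
    rw [e] at h2
    have h3 : Real.exp (-(x ^ 2 / (2 * ((n + 1 - k : ℕ) : ℝ))))
        ≤ Real.exp (-(1 / (2 * (n : ℝ)) * x ^ 2)) := by
      apply Real.exp_le_exp.2
      rw [neg_le_neg_iff, one_div_mul_eq_div]
      gcongr
    calc _ ≤ ((d * n) ^ (d / 2) * Real.exp (1 / (2 * (n : ℝ)) * x ^ 2)) *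
          Real.exp (-(1 / (2 * (n : ℝ)) * x ^ 2)) := by gcongr
      _ = _ := by rw [mul_assoc, ← Real.exp_add, add_neg_cancel, Real.exp_zero, mul_one]
  calc _ ≤ ∑ x ∈ range (n + 1), (d * n) ^ (d / 2) * (((x : ℝ) + 1) * aliveProb k x) :=
        sum_le_sum fun x _ => mul_le_mul_of_nonneg_right (h1 x)
          (mul_nonneg (by positivity) (aliveProb_nonneg k x))
    _ ≤ _ := by
        rw [← mul_sum]
        exact mul_le_of_le_one_right (by positivity) (sum_add_one_mul_aliveProb_le k _)

lemma cast_div_sub_nonneg {n k : ℕ} (hk : k < n) : 0 ≤ (n : ℝ) / ((n : ℝ) - k) := by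
  have : (k : ℝ) < n := by exact_mod_cast hk
  exact div_nonneg (Nat.cast_nonneg n) (by linarith)

lemma momentSum_le_start {n k : ℕ} (hk1 : 1 ≤ k) (hk : k < n) {d : ℝ} (hd : 0 < d) :
    momentSum n k d ≤ ((n : ℝ) / ((n : ℝ) - k)) ^ ((3 : ℝ) / 2) *
      (54 * (2 * d * √(k : ℝ)) ^ d) := by
  have hkn : (k : ℝ) < n := by exact_mod_cast hk
  have hk' : (0 : ℝ) < k := by exact_mod_cast hk1
  have hm : ((n + 1 - k : ℕ) : ℝ) = n + 1 - k := by
    rw [Nat.cast_sub (by omega)]; push_cast; ring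
  have hr : ((n : ℝ) + 1) / ((n + 1 - k : ℕ) : ℝ) ≤ (n : ℝ) / ((n : ℝ) - k) := by
    rw [hm, div_le_div_iff₀ (by linarith) (by linarith)]
    nlinarith
  have hr0 : 0 ≤ ((n : ℝ) + 1) / ((n + 1 - k : ℕ) : ℝ) := by positivity
  refine (sum_le_sum fun x _ => momentSum_term_le hk.le d x).trans ?_
  rw [← mul_sum]
  set s := 1 / √(k : ℝ) with hs
  have hs0 : 0 < s := by positivity
  have h1 : ∀ x : ℕ, (x : ℝ) ^ d * Real.exp (-(x ^ 2 / (2 * ((n + 1 - k : ℕ) : ℝ)))) *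
      (((x : ℝ) + 1) * aliveProb k x) ≤ (2 / s) * (2 * d * √(k : ℝ)) ^ d *
        (Real.sinh (s * ((x + 1 : ℕ) : ℝ)) * aliveProb k x) := by
    intro x
    have hx : (0 : ℝ) ≤ x := Nat.cast_nonneg x
    have h2 : Real.exp (-(x ^ 2 / (2 * ((n + 1 - k : ℕ) : ℝ)))) ≤ 1 :=
      Real.exp_le_one_iff.2 (neg_nonpos.2 (by positivity))
    have h3 : (x : ℝ) ^ d ≤ ((x + 1 : ℕ) : ℝ) ^ d :=
      Real.rpow_le_rpow hx (by push_cast; linarith) hd.le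
    have h4 := rpow_le_mul_exp (Nat.cast_nonneg (x + 1)) hd (half_pos hs0)
    have e : d / (s / 2) = 2 * d * √(k : ℝ) := by rw [hs]; field_simp
    rw [e] at h4
    set y : ℝ := ((x + 1 : ℕ) : ℝ) with hy
    have hy0 : 0 ≤ y := Nat.cast_nonneg _
    have hyx : (x : ℝ) + 1 = y := by rw [hy]; push_cast; ring
    -- By the double-angle formula, `sinh` controls both the harmonic weight `y = x + 1` and an
    -- exponential at half the rate.
    have h5 : s / 2 * y * Real.exp (s / 2 * y) ≤ Real.sinh (s * y) := by
      have h6 : s / 2 * y ≤ Real.sinh (s / 2 * y) := Real.self_le_sinh_iff.2 (by positivity)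
      have h7 : Real.exp (s / 2 * y) / 2 ≤ Real.cosh (s / 2 * y) := by
        rw [Real.cosh_eq]; have := Real.exp_pos (-(s / 2 * y)); linarith
      rw [show s * y = 2 * (s / 2 * y) by ring, Real.sinh_two_mul]
      have := mul_le_mul h6 h7 (by positivity) (Real.sinh_nonneg_iff.2 (by positivity))
      linarith
    have ha := aliveProb_nonneg k x
    rw [hyx]
    calc _ ≤ ((2 * d * √(k : ℝ)) ^ d * Real.exp (s / 2 * y)) * 1 * (y * aliveProb k x) := by
          gcongr
          exact h3.trans h4
      _ = (2 / s) * (2 * d * √(k : ℝ)) ^ d *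
          ((s / 2 * y * Real.exp (s / 2 * y)) * aliveProb k x) := by field_simp
      _ ≤ _ := by gcongr
  have h8 := sum_le_sum fun x (_ : x ∈ range (n + 1)) => h1 x
  rw [← mul_sum] at h8
  have h9 := h8.trans (mul_le_mul_of_nonneg_left
    (sum_sinh_div_sqrt_mul_aliveProb_le hk1 (n + 1)) (by positivity))
  calc _ ≤ 3 * ((n : ℝ) / ((n : ℝ) - k)) ^ ((3 : ℝ) / 2) *
        ((2 / s) * (2 * d * √(k : ℝ)) ^ d * (9 * s)) := by
        refine mul_le_mul ?_ h9 ?_ ?_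
        · gcongr
        · exact sum_nonneg fun x _ => mul_nonneg (by positivity)
            (mul_nonneg (by positivity) (aliveProb_nonneg k x))
        · have := cast_div_sub_nonneg hk
          positivity
    _ = _ := by field_simp; ring

lemma sum_exp_neg_mul_le {a : ℝ} (ha : 0 < a) (N : ℕ) :
    ∑ x ∈ range N, Real.exp (-(a * x)) ≤ 1 + 1 / a := by
  have h1 : Real.exp (-a) < 1 := Real.exp_lt_one_iff.mpr (by linarith)
  have h := sum_le_hasSum (range N) (fun i _ => by positivity)
    (hasSum_geometric_of_lt_one (Real.exp_pos (-a)).le h1)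
  have e : ∀ x ∈ range N, Real.exp (-(a * x)) = Real.exp (-a) ^ x := fun x _ => by
    rw [← Real.exp_nat_mul]; ring_nf
  rw [sum_congr rfl e]
  refine h.trans ?_
  rw [inv_le_comm₀ (by linarith) (by positivity)]
  have h2 : Real.exp (-a) ≤ 1 / (a + 1) := by
    rw [Real.exp_neg, ← one_div]
    exact one_div_le_one_div_of_le (by positivity) (Real.add_one_le_exp a)
  have e2 : (1 + 1 / a)⁻¹ = 1 - 1 / (a + 1) := by field_simp; ring
  rw [e2]
  linarith

/-- The Gaussian exponent is shared out as `1/(2K) = 1/(8K) + 1/(8K) + 1/(4K)`: one part for `x ^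
d`, one for `(x + 1) ^ 2`, and the last for a geometric series of sum `O(√K)`. -/
lemma sum_rpow_mul_sq_mul_exp_le {K : ℝ} (hK : 1 ≤ K) {d : ℝ} (hd : 0 < d) (N : ℕ) :
    ∑ x ∈ range N, (x : ℝ) ^ d * ((x : ℝ) + 1) ^ 2 * Real.exp (-(x ^ 2 / (2 * K)))
      ≤ 108 * (4 * d * K) ^ (d / 2) * (K * √K) := by
  have hK0 : 0 < K := by linarith
  have hsK : √K * √K = K := Real.mul_self_sqrt hK0.le
  have hsK1 : 1 ≤ √K := Real.one_le_sqrt.2 hK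
  have h1 : ∀ x : ℕ, (x : ℝ) ^ d * ((x : ℝ) + 1) ^ 2 * Real.exp (-(x ^ 2 / (2 * K)))
      ≤ 36 * (4 * d * K) ^ (d / 2) * K * Real.exp (-(1 / (2 * √K) * x)) := by
    intro x
    have hx : (0 : ℝ) ≤ x := Nat.cast_nonneg x
    have h2 := self_rpow_le_mul_exp_sq hx hd (by positivity : 0 < 1 / (8 * K))
    have e : d / (2 * (1 / (8 * K))) = 4 * d * K := by field_simp; ring
    rw [e] at h2
    have h3 : ((x : ℝ) + 1) ^ 2 ≤ 18 * K * Real.exp (1 / (8 * K) * x ^ 2) := by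
      have h4 := Real.add_one_le_exp (1 / (8 * K) * (x : ℝ) ^ 2)
      have h5 := mul_le_mul_of_nonneg_left h4 (by positivity : 0 ≤ 18 * K)
      refine le_trans ?_ h5
      have e3 : 18 * K * (1 / (8 * K) * (x : ℝ) ^ 2 + 1) = 9 / 4 * (x : ℝ) ^ 2 + 18 * K := by
        field_simp; ring
      rw [e3]
      nlinarith [sq_nonneg ((x : ℝ) - 1)]
    set z := (x : ℝ) / (2 * √K) with hz
    have hz2 : z ^ 2 = x ^ 2 / (4 * K) := by
      rw [hz, div_pow, mul_pow, Real.sq_sqrt hK0.le]; norm_num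
    have h6 : Real.exp (-(x ^ 2 / (4 * K))) ≤ 2 * Real.exp (-(1 / (2 * √K) * x)) := by
      have e4 : 1 / (2 * √K) * (x : ℝ) = z := by rw [hz]; ring
      rw [e4, ← hz2]
      have h7 : Real.exp (1 / 4) ≤ 2 := by
        have := Real.exp_bound' (x := 1 / 4) (by norm_num) (by norm_num) (n := 1) (by norm_num)
        norm_num at this
        linarith
      calc Real.exp (-z ^ 2) ≤ Real.exp (1 / 4 + -z) :=
            Real.exp_le_exp.2 (by nlinarith [sq_nonneg (z - 1 / 2)])
        _ = Real.exp (1 / 4) * Real.exp (-z) := Real.exp_add _ _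
        _ ≤ _ := by gcongr
    calc _ ≤ ((4 * d * K) ^ (d / 2) * Real.exp (1 / (8 * K) * x ^ 2)) *
          (18 * K * Real.exp (1 / (8 * K) * x ^ 2)) * Real.exp (-(x ^ 2 / (2 * K))) := by gcongr
      _ = 18 * (4 * d * K) ^ (d / 2) * K * Real.exp (-(x ^ 2 / (4 * K))) := by
          have e5 : -((x : ℝ) ^ 2 / (4 * K)) = 1 / (8 * K) * x ^ 2 + 1 / (8 * K) * x ^ 2
            + -(x ^ 2 / (2 * K)) := by field_simp; ring
          rw [e5, Real.exp_add, Real.exp_add]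
          ring
      _ ≤ 18 * (4 * d * K) ^ (d / 2) * K * (2 * Real.exp (-(1 / (2 * √K) * x))) := by gcongr
      _ = _ := by ring
  refine (sum_le_sum fun x _ => h1 x).trans ?_
  rw [← mul_sum]
  have h8 := sum_exp_neg_mul_le (by positivity : 0 < 1 / (2 * √K)) N
  rw [one_div_one_div] at h8
  calc _ ≤ 36 * (4 * d * K) ^ (d / 2) * K * (3 * √K) := by
        gcongr
        linarith
    _ = _ := by ring

lemma two_rpow_three_halves_le : (2 : ℝ) ^ ((3 : ℝ) / 2) ≤ 3 := by
  rw [← mul_sqrt_eq_rpow zero_le_two]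
  have : √(2 : ℝ) ≤ 3 / 2 := Real.sqrt_le_iff.2 ⟨by norm_num, by norm_num⟩
  linarith

lemma momentSum_le_end {n k : ℕ} (hk1 : 1 ≤ k) (hk : k < n) {d : ℝ} (hd : 0 < d) :
    momentSum n (n - k) d ≤ ((n : ℝ) / ((n : ℝ) - k)) ^ ((3 : ℝ) / 2) *
      (12000000 * (8 * d * k) ^ (d / 2)) := by
  have hkn : (k : ℝ) < n := by exact_mod_cast hk
  have hk' : (1 : ℝ) ≤ k := by exact_mod_cast hk1
  have hn1 : (1 : ℝ) ≤ n := by linarith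
  have hm : ((n - k : ℕ) : ℝ) = n - k := Nat.cast_sub hk.le
  have hm0 : (0 : ℝ) < (n : ℝ) - k := by linarith
  set m : ℝ := (n : ℝ) - k with hmd
  -- At time `n - k` exactly `k + 1` steps remain before the hit of `-1`.
  set K : ℝ := (k : ℝ) + 1 with hKd
  have hK : 1 ≤ K := by linarith
  have h1 : ∀ x ∈ range (n + 1), (x : ℝ) ^ d *
      (aliveProb (n - k) x * hitProb (n + 1 - (n - k)) (x + 1) / hitProb (n + 1) 1)
      ≤ 36000 * (((n : ℝ) + 1) / m) ^ ((3 : ℝ) / 2) * (1 / (K * √K)) *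
        ((x : ℝ) ^ d * ((x : ℝ) + 1) ^ 2 * Real.exp (-(x ^ 2 / (2 * K)))) := by
    intro x _
    have hx : (0 : ℝ) ≤ x := Nat.cast_nonneg x
    refine (momentSum_term_le (Nat.sub_le n k) d x).trans ?_
    have h2 := aliveProb_le (m := n - k) (by omega) x
    rw [hm, mul_sqrt_eq_rpow hm0.le] at h2
    have e : ((n + 1 - (n - k) : ℕ) : ℝ) = K := by
      rw [show n + 1 - (n - k) = k + 1 by omega]; push_cast; rfl
    rw [e, mul_sqrt_eq_rpow (by positivity), Real.div_rpow (by positivity) (by positivity),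
      Real.div_rpow (by positivity) hm0.le]
    calc _ ≤ 3 * (((n : ℝ) + 1) ^ ((3 : ℝ) / 2) / K ^ ((3 : ℝ) / 2)) *
          ((x : ℝ) ^ d * Real.exp (-(x ^ 2 / (2 * K))) *
            (((x : ℝ) + 1) * (12000 * ((x : ℝ) + 1) / m ^ ((3 : ℝ) / 2)))) := by gcongr
      _ = _ := by ring
  refine (sum_le_sum h1).trans ?_
  rw [← mul_sum]
  have h3 := sum_rpow_mul_sq_mul_exp_le hK hd (n + 1)
  have h4 : (((n : ℝ) + 1) / m) ^ ((3 : ℝ) / 2) ≤ 3 * ((n : ℝ) / m) ^ ((3 : ℝ) / 2) := by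
    calc (((n : ℝ) + 1) / m) ^ ((3 : ℝ) / 2) ≤ (2 * ((n : ℝ) / m)) ^ ((3 : ℝ) / 2) := by
          refine Real.rpow_le_rpow (by positivity) ?_ (by norm_num)
          rw [← mul_div_assoc]
          gcongr
          linarith
      _ = (2 : ℝ) ^ ((3 : ℝ) / 2) * ((n : ℝ) / m) ^ ((3 : ℝ) / 2) :=
          Real.mul_rpow zero_le_two (by positivity)
      _ ≤ _ := by gcongr; exact two_rpow_three_halves_le
  have h5 : (4 * d * K) ^ (d / 2) ≤ (8 * d * k) ^ (d / 2) := by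
    refine Real.rpow_le_rpow (by positivity) ?_ (by positivity)
    nlinarith
  calc _ ≤ 36000 * (3 * ((n : ℝ) / m) ^ ((3 : ℝ) / 2)) * (1 / (K * √K)) *
        (108 * (8 * d * k) ^ (d / 2) * (K * √K)) := by
        refine mul_le_mul (by gcongr) (h3.trans (by gcongr)) ?_ (by positivity)
        exact sum_nonneg fun x _ => by positivity
    _ = ((n : ℝ) / m) ^ ((3 : ℝ) / 2) * (11664000 * (8 * d * k) ^ (d / 2)) := by
        field_simp; ring
    _ ≤ _ := by gcongr; norm_num

/-- As `d ≥ 1`, a constant prefactor is at most its `d`-th power and can enter the base. -/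
lemma mul_rpow_half_le {A c y d : ℝ} (hA : 1 ≤ A) (hc : 0 ≤ c) (hy : 0 ≤ y) (hd : 1 ≤ d) :
    A * (c * y) ^ (d / 2) ≤ (A ^ 2 * c * y) ^ (d / 2) := by
  rw [mul_assoc, Real.mul_rpow (x := A ^ 2) (by positivity) (by positivity)]
  refine mul_le_mul_of_nonneg_right ?_ (by positivity)
  rw [← Real.rpow_natCast, ← Real.rpow_mul (by positivity), Nat.cast_ofNat,
    mul_div_cancel₀ _ two_ne_zero]
  exact Real.self_le_rpow_of_one_le hA hd

end PoissonExcursion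

theorem proposition8 :
    ∃ C : ℝ, 0 < C ∧
      ∀ {Ω : Type*} [MeasurableSpace Ω] (P : Measure Ω) [IsProbabilityMeasure P]
        (X : ℕ → Ω → ℕ),
        (∀ i, Measurable (X i)) → iIndepFun X P → (∀ i, P.map (X i) = poissonMeasure 1) →
        ∀ n : ℕ, 2 ≤ n →
          -- the conditioning is on an event of positive probability
          0 < P (excursion X n) ∧
          ∀ k : ℕ, 1 ≤ k → k ≤ n - 1 → ∀ d : ℝ, 1 ≤ d →
            -- the moments are finite
            Integrable (fun ω => (walk X k ω : ℝ) ^ d) (excursionMeasure P X n) ∧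
            excursionMoment P X n k d ≤ (C * d * n) ^ (d / 2) ∧
            excursionMoment P X n (n - k) d ≤
              ((n : ℝ) / ((n : ℝ) - k)) ^ ((3 : ℝ) / 2) * (C * d * k) ^ (d / 2) ∧
            excursionMoment P X n k d ≤
              ((n : ℝ) / ((n : ℝ) - k)) ^ ((3 : ℝ) / 2) * (C * d * √(k : ℝ)) ^ d := by
  -- `36000000` is the constant `12000000` of `momentSum_le_end` times the bound `3` on `2 ^ (3/2)`;
  -- it is squared by `mul_rpow_half_le`.
  refine ⟨36000000 ^ 2 * 8, by norm_num, ?_⟩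
  intro Ω _ P _ X hX hind hlaw n hn
  refine ⟨?_, fun k hk1 hk d hd => ?_⟩
  · have h := PoissonExcursion.hitProb_one_pos n
    rw [← PoissonExcursion.measureReal_excursion hX hind hlaw n] at h
    exact (ENNReal.toReal_pos_iff.1 h).1
  have hkn : k < n := by omega
  have hkn' : (k : ℝ) < n := by exact_mod_cast hkn
  have hk' : (1 : ℝ) ≤ k := by exact_mod_cast hk1
  have hd0 : 0 < d := by linarith
  have hr := PoissonExcursion.cast_div_sub_nonneg hkn
  obtain ⟨hint, hmk⟩ := PoissonExcursion.moment_eq hX hind hlaw hkn.le d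
  obtain ⟨-, hmnk⟩ := PoissonExcursion.moment_eq hX hind hlaw (Nat.sub_le n k) d
  rw [hmk, hmnk]
  change _ ∧ PoissonExcursion.momentSum n k d ≤ _ ∧ PoissonExcursion.momentSum n (n - k) d ≤ _ ∧
    PoissonExcursion.momentSum n k d ≤ _
  refine ⟨hint, ?_, ?_, ?_⟩
  · have hA := PoissonExcursion.mul_rpow_half_le (A := 36000000) (c := 8) (y := d * n)
      (by norm_num) (by norm_num) (by positivity) hd
    rw [← mul_assoc (_ * _) d] at hA
    refine le_trans ?_ hA
    have hmul : ∀ r : ℝ, 0 ≤ r → r ≤ 2 → r ^ ((3 : ℝ) / 2) ≤ 3 := fun r h0 h2 =>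
      (Real.rpow_le_rpow h0 h2 (by norm_num)).trans PoissonExcursion.two_rpow_three_halves_le
    -- In each half the ratio raised to the power `3/2` is at most `2`; in the second half, (ii) is
    -- used with `n - k` in place of `k`, so the ratio is `n / k`.
    rcases le_or_gt (2 * k) n with h2k | h2k
    · have h2k' : 2 * (k : ℝ) ≤ n := by exact_mod_cast h2k
      refine (PoissonExcursion.momentSum_le_gaussian hk1 hkn.le hd0).trans ?_
      have hm : ((n + 1 - k : ℕ) : ℝ) = n + 1 - k := by
        rw [Nat.cast_sub (by omega)]; push_cast; ring
      have h3 : (((n : ℝ) + 1) / ((n + 1 - k : ℕ) : ℝ)) ^ ((3 : ℝ) / 2) ≤ 3 := by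
        refine hmul _ (by positivity) ?_
        rw [hm, div_le_iff₀ (by linarith)]
        linarith
      have h4 : (d * n) ^ (d / 2) ≤ (8 * (d * n)) ^ (d / 2) := by
        refine Real.rpow_le_rpow (by positivity) ?_ (by positivity)
        linarith [(by positivity : 0 ≤ d * n)]
      calc _ ≤ 3 * 3 * (8 * (d * n)) ^ (d / 2) := by gcongr
        _ ≤ _ := by gcongr; norm_num
    · have h := PoissonExcursion.momentSum_le_end (n := n) (k := n - k) (by omega) (by omega) hd0
      rw [Nat.sub_sub_self hkn.le, Nat.cast_sub hkn.le, sub_sub_cancel] at h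
      refine h.trans ?_
      have h2k' : (n : ℝ) < 2 * k := by exact_mod_cast h2k
      have h3 : ((n : ℝ) / k) ^ ((3 : ℝ) / 2) ≤ 3 := by
        refine hmul _ (by positivity) ?_
        rw [div_le_iff₀ (by linarith)]
        exact h2k'.le
      have h4 : (8 * d * ((n : ℝ) - k)) ^ (d / 2) ≤ (8 * (d * n)) ^ (d / 2) := by
        refine Real.rpow_le_rpow (mul_nonneg (by positivity) (by linarith)) ?_ (by positivity)
        nlinarith
      have h5 : 0 ≤ (8 * d * ((n : ℝ) - k)) ^ (d / 2) :=
        Real.rpow_nonneg (mul_nonneg (by positivity) (by linarith)) _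
      calc _ ≤ 3 * (12000000 * (8 * (d * n)) ^ (d / 2)) := by gcongr
        _ = _ := by ring
  · refine (PoissonExcursion.momentSum_le_end hk1 hkn hd0).trans
      (mul_le_mul_of_nonneg_left ?_ (by positivity))
    have hA := PoissonExcursion.mul_rpow_half_le (A := 36000000) (c := 8) (y := d * k)
      (by norm_num) (by norm_num) (by positivity) hd
    rw [← mul_assoc (_ * _) d, ← mul_assoc 8 d] at hA
    refine le_trans ?_ hA
    gcongr
    norm_num
  · refine (PoissonExcursion.momentSum_le_start hk1 hkn hd0).trans
      (mul_le_mul_of_nonneg_left ?_ (by positivity))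
    have h54 : (54 : ℝ) ≤ 54 ^ d := Real.self_le_rpow_of_one_le (by norm_num) hd
    calc 54 * (2 * d * √(k : ℝ)) ^ d ≤ 54 ^ d * (2 * d * √(k : ℝ)) ^ d := by gcongr
      _ = (54 * (2 * d * √(k : ℝ))) ^ d := (Real.mul_rpow (by norm_num) (by positivity)).symm
      _ ≤ _ := by
          refine Real.rpow_le_rpow (by positivity) ?_ hd0.le
          have : 0 ≤ d * √(k : ℝ) := by positivity
          nlinarith
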